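/- All graphs are finite and simple. For a positive integer $k$, a graph $G$ is \emph{$k$-connected} if $|V(G)| > k$ and $G - X$ is connected for every set $X \subseteq V(G)$ with $|X| < k$ (in particular, $G$ itself is connected). A graph $G$ is \emph{super-minimally $k$-connected} if $G$ is $k$-connected but no proper subgraph of $G$ is $k$-connected. The \emph{wheel with $n \geq 3$ spokes} is the graph obtained from a cycle with $n$ vertices by adding one new vertex adjacent to all vertices of the cycle. If $G$ is a super-minimally $3$-connected graph, then $$|E(G)| \le 2|V(G)| - 2.$$ Moreover, equality holds if and only if $G$ is a wheel with at least three spokes (that is, isomorphic to the wheel with $n$ spokes for some $n \geq 3$). -/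

import Mathlib

namespace SimpleGraph

/-- A finite graph is `k`-connected if it has more than `k` vertices and deleting any set of fewer
than `k` vertices leaves a connected graph (for `k ≥ 1`, the case `X = ∅` says that the graph itself
is connected). -/
def IsKConnected {V : Type*} [Finite V] (G : SimpleGraph V) (k : ℕ) : Prop :=
  k < Nat.card V ∧ ∀ X : Finset V, X.card < k → (G.induce {v : V | v ∉ X}).Connected

/-- A finite graph is super-minimally `k`-connected if it is `k`-connected and no proper subgraph
(obtained by deleting vertices and edges, at least one in total) is `k`-connected. -/
def IsSuperMinimallyKConnected {V : Type*} [Finite V] (G : SimpleGraph V) (k : ℕ) : Prop :=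
  G.IsKConnected k ∧ ∀ H : G.Subgraph, H ≠ ⊤ → ¬ H.coe.IsKConnected k

/-- The wheel with `n` spokes: the cycle on `Fin n` (the rim) together with a further vertex `none`
(the hub) that is adjacent to every vertex of the rim. -/
def wheelGraph (n : ℕ) : SimpleGraph (Option (Fin n)) where
  Adj
    | none, none => False
    | none, some _ => True
    | some _, none => True
    | some i, some j => (cycleGraph n).Adj i j
  symm := ⟨by
    rintro (_ | i) (_ | j) h
    · exact h
    · trivial
    · trivial
    · exact (cycleGraph n).adj_symm h⟩
  loopless := ⟨by
    rintro (_ | i) h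
    · exact h
    · exact (cycleGraph n).irrefl h⟩

/-- A graph is a wheel with at least three spokes. -/
def IsWheel {V : Type*} (G : SimpleGraph V) : Prop :=
  ∃ n : ℕ, 3 ≤ n ∧ Nonempty (G ≃g wheelGraph n)

end SimpleGraph

section

open Finset

set_option linter.unusedSectionVars false

namespace SimpleGraph

variable {V : Type*} [DecidableEq V]

/-! Let `D` be the degree sum, twice the number of edges. By strong induction on `#W`,
`SuperminimalOn.hubbedOn_or` shows that a super-minimal graph on `W` is hubbed, in which case `D = 4
* #W - 4`, or has `D ≤ 4 * #W - 6`. This gap is what carries the equality case through the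
induction. A 3-connected hubbed graph is a wheel, since deleting the hub leaves a connected
2-regular graph.

Suppose that the set `T` of vertices of degree above 3 is independent (`hubbedOn_or_of_indep`). If
`#T ≤ 1`, all but one vertex are cubic and the degree of the last one decides. Otherwise the cubic
vertices `Z` have `D(Z) ≥ 2 * #Z - 2c`, where `c` is the number of components of `Z`, so `D = 6 * #Z
- D(Z)` is controlled by a bound on `c`. That bound, `card_parts_le`, holds because no proper vertex
subset induces a 3-connected graph.

Otherwise some edge `xy` has both ends of degree at least 4. Deleting it creates a separation of
order 2, so `G` splits into sides `L`, `R` joined by three ports: the edge `xy` and two common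
vertices. A common vertex with only one neighbour strictly inside a side is traded for the edge to
that neighbour (`LinkedBy.exists_wellLinkedBy`). Replacing one side by a single vertex joined to the
three ports gives a smaller graph that is again super-minimal (`WellLinkedBy.superminimalOn_left`):
a smaller 3-connected subgraph of it could be glued back to the other side
(`Ported.triconnectedOn_glue`). The edge counts of the two side graphs then add up to the bound. If
common vertices remain, the count needs that neither side graph is hubbed
(`WellLinkedBy.not_hubbedOn`). -/

/-- The graph that `G` induces on `W` is `3`-connected: it has at least four vertices, and any two
nonempty disjoint parts with no edge between them leave out at least three vertices. -/
def TriconnectedOn (G : SimpleGraph V) (W : Finset V) : Prop :=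
  4 ≤ #W ∧ ∀ P ⊆ W, ∀ Q ⊆ W, P.Nonempty → Q.Nonempty → Disjoint P Q →
    (∀ u ∈ P, ∀ w ∈ Q, ¬ G.Adj u w) → 3 ≤ #(W \ (P ∪ Q))

/-- The graph that `G` induces on `W` is super-minimally `3`-connected. -/
def SuperminimalOn (G : SimpleGraph V) (W : Finset V) : Prop :=
  G.TriconnectedOn W ∧ ∀ W' ⊆ W, ∀ H ≤ G, H.TriconnectedOn W' →
    W' = W ∧ ∀ u ∈ W, ∀ w ∈ W, G.Adj u w → H.Adj u w

open Classical in
/-- The neighbours of `u` in `W`. -/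
noncomputable def nbrs (G : SimpleGraph V) (W : Finset V) (u : V) : Finset V :=
  {w ∈ W | G.Adj u w}

/-- The sum of the degrees in the graph that `G` induces on `W`. -/
noncomputable def degreeSumOn (G : SimpleGraph V) (W : Finset V) : ℕ :=
  ∑ u ∈ W, #(G.nbrs W u)

/-- Some vertex of `W` is adjacent to all others, and these have degree `3` within `W`. -/
def HubbedOn (G : SimpleGraph V) (W : Finset V) : Prop :=
  ∃ h ∈ W, ∀ u ∈ W, u ≠ h → G.Adj h u ∧ #(G.nbrs W u) = 3

variable {G H A B K : SimpleGraph V} {W W' P Q X L R : Finset V} {u v w x y : V}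
  {α β : Fin 3 → V}

/-! ### Separations and degree sums within a vertex set -/

@[simp] lemma mem_nbrs : w ∈ G.nbrs W u ↔ w ∈ W ∧ G.Adj u w := by
  simp [nbrs]

lemma nbrs_subset : G.nbrs W u ⊆ W := fun _ h => (mem_nbrs.1 h).1

lemma nbrs_union : G.nbrs (W ∪ W') u = G.nbrs W u ∪ G.nbrs W' u := by
  ext; simp [or_and_right]

lemma card_nbrs_union (h : Disjoint W W') :
    #(G.nbrs (W ∪ W') u) = #(G.nbrs W u) + #(G.nbrs W' u) := by
  rw [nbrs_union, card_union_of_disjoint (h.mono nbrs_subset nbrs_subset)]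

lemma TriconnectedOn.not_separated (hG : G.TriconnectedOn W) (hP : P ⊆ W) (hQ : Q ⊆ W)
    (hP' : P.Nonempty) (hQ' : Q.Nonempty) (hPQ : Disjoint P Q)
    (h : ∀ u ∈ P, ∀ w ∈ Q, ¬ G.Adj u w) (hW : W ⊆ P ∪ Q ∪ X) (hX : #X ≤ 2) : False := by
  have h3 := hG.2 P hP Q hQ hP' hQ' hPQ h
  have : W \ (P ∪ Q) ⊆ X := by
    intro v hv
    simp only [mem_sdiff] at hv
    have := hW hv.1
    simp only [mem_union] at *
    tauto
  have := card_le_card this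
  omega

lemma TriconnectedOn.three_le_card_nbrs (hG : G.TriconnectedOn W) (hu : u ∈ W) :
    3 ≤ #(G.nbrs W u) := by
  by_contra! h
  have hcov : W ⊆ {u} ∪ (W \ insert u (G.nbrs W u)) ∪ G.nbrs W u := by
    intro v hv
    simp only [mem_union, mem_singleton, mem_sdiff, mem_insert]
    tauto
  by_cases hQ : (W \ insert u (G.nbrs W u)).Nonempty
  · refine hG.not_separated (P := {u}) (by simpa) sdiff_subset (by simp) hQ (by simp) ?_ hcov
      (by omega)
    intro a ha w hw
    simp only [mem_singleton] at ha
    simp only [mem_sdiff, mem_insert, mem_nbrs, not_or, not_and] at hw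
    subst ha
    exact hw.2.2 hw.1
  · rw [not_nonempty_iff_eq_empty] at hQ
    rw [hQ, union_empty] at hcov
    have h1 := card_le_card hcov
    have h2 := card_union_le {u} (G.nbrs W u)
    have := hG.1
    simp only [card_singleton] at h2
    omega

lemma TriconnectedOn.mono (hH : H.TriconnectedOn W)
    (h : ∀ u ∈ W, ∀ w ∈ W, H.Adj u w → G.Adj u w) : G.TriconnectedOn W :=
  ⟨hH.1, fun P hP Q hQ hP' hQ' hPQ hadj =>
    hH.2 P hP Q hQ hP' hQ' hPQ fun u hu w hw huw => hadj u hu w hw (h u (hP hu) w (hQ hw) huw)⟩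

lemma not_triconnectedOn (h : ¬ G.TriconnectedOn W) (hW : 4 ≤ #W) :
    ∃ P ⊆ W, ∃ Q ⊆ W, P.Nonempty ∧ Q.Nonempty ∧ Disjoint P Q ∧
      (∀ u ∈ P, ∀ w ∈ Q, ¬ G.Adj u w) ∧ #(W \ (P ∪ Q)) ≤ 2 := by
  simp only [TriconnectedOn, hW, true_and] at h
  push Not at h
  obtain ⟨P, hP, Q, hQ, h1, h2, h3, h4, h5⟩ := h
  exact ⟨P, hP, Q, hQ, h1, h2, h3, h4, by omega⟩

lemma even_degreeSumOn : Even (G.degreeSumOn W) := by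
  classical
  let H := G.induce (W : Set V)
  have h := H.sum_degrees_eq_twice_card_edges
  have : ∑ v, H.degree v = G.degreeSumOn W := by
    rw [degreeSumOn, ← sum_coe_sort W]
    refine sum_congr rfl fun v _ => ?_
    rw [← card_neighborFinset_eq_degree]
    refine card_bij (fun a _ => a.1) ?_ ?_ ?_
    · intro a ha
      simp only [mem_neighborFinset] at ha
      simp only [mem_nbrs]
      exact ⟨a.2, ha⟩
    · intro a _ b _ hab
      exact Subtype.ext hab
    · intro b hb
      simp only [mem_nbrs] at hb
      exact ⟨⟨b, hb.1⟩, by simpa [H] using hb.2, rfl⟩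
  rw [← this, h]
  exact even_two_mul _

lemma sum_card_nbrs_comm (A B : Finset V) :
    ∑ u ∈ A, #(G.nbrs B u) = ∑ u ∈ B, #(G.nbrs A u) := by
  classical
  simp only [nbrs, card_filter]
  rw [sum_comm]
  simp only [G.adj_comm]

lemma degreeSumOn_union (h : Disjoint W W') : G.degreeSumOn (W ∪ W') =
    G.degreeSumOn W + G.degreeSumOn W' + 2 * ∑ u ∈ W, #(G.nbrs W' u) := by
  rw [degreeSumOn, sum_union h]
  simp only [card_nbrs_union h, sum_add_distrib]
  rw [sum_card_nbrs_comm W' W]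
  simp only [degreeSumOn]
  ring

/-! ### Indivisible parts and a bound on their number -/

/-- The nonempty set `K` lies on one side of every pair of disjoint sets without edges between
them. -/
def IndivisibleOn (G : SimpleGraph V) (K : Finset V) : Prop :=
  K.Nonempty ∧ ∀ P Q, K ⊆ P ∪ Q → Disjoint P Q → (∀ u ∈ P, ∀ w ∈ Q, ¬ G.Adj u w) →
    K ⊆ P ∨ K ⊆ Q

lemma indivisibleOn_insert_biUnion {z : V} {N : Finset (Finset V)}
    (hN : ∀ K ∈ N, G.IndivisibleOn K ∧ ∃ u ∈ K, G.Adj z u) :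
    G.IndivisibleOn (insert z (N.biUnion id)) := by
  refine ⟨insert_nonempty _ _, ?_⟩
  have key : ∀ P Q : Finset V, insert z (N.biUnion id) ⊆ P ∪ Q →
      (∀ u ∈ P, ∀ w ∈ Q, ¬ G.Adj u w) → Disjoint P Q → z ∈ P →
      insert z (N.biUnion id) ⊆ P := by
    intro P Q hK hadj hPQ hz
    refine insert_subset hz (biUnion_subset.2 fun K hK' => ?_)
    obtain ⟨hK1, u, hu, hzu⟩ := hN K hK'
    have hsub : K ⊆ P ∪ Q := fun v hv =>
      hK (mem_insert_of_mem (mem_biUnion.2 ⟨K, hK', hv⟩))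
    rcases hK1.2 P Q hsub hPQ hadj with h | h
    · exact h
    · exact absurd hzu (hadj z hz u (h hu))
  intro P Q hK hPQ hadj
  rcases mem_union.1 (hK (mem_insert_self _ _)) with hz | hz
  · exact Or.inl (key P Q hK hadj hPQ hz)
  · exact Or.inr (key Q P (by rwa [union_comm]) (fun u hu w hw h => hadj w hw u hu h.symm)
      hPQ.symm hz)

/-- A vertex set splits into indivisible parts without edges between them, and it spans at least
as many edges as a forest with that many components. -/
lemma exists_components (G : SimpleGraph V) (Z : Finset V) : ∃ C : Finset (Finset V),
    (∀ K ∈ C, G.IndivisibleOn K) ∧ C.biUnion id = Z ∧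
    (∀ K ∈ C, ∀ L ∈ C, K ≠ L → Disjoint K L ∧ ∀ u ∈ K, ∀ w ∈ L, ¬ G.Adj u w) ∧
    2 * #Z ≤ G.degreeSumOn Z + 2 * #C := by
  classical
  induction Z using Finset.induction_on with
  | empty => exact ⟨∅, by simp⟩
  | insert z Z hz ih =>
    obtain ⟨C, h1, h2, h3, h4⟩ := ih
    set N := C.filter fun K => ∃ u ∈ K, G.Adj z u with hN
    have hNC : N ⊆ C := filter_subset _ _
    have hzC : ∀ K ∈ C, z ∉ K := fun K hK hzK => hz (h2 ▸ mem_biUnion.2 ⟨K, hK, hzK⟩)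
    have hM : insert z (N.biUnion id) ∉ C \ N := fun h =>
      hzC _ (mem_sdiff.1 h).1 (mem_insert_self _ _)
    have hout : ∀ K ∈ C \ N, Disjoint (insert z (N.biUnion id)) K ∧
        ∀ u ∈ insert z (N.biUnion id), ∀ w ∈ K, ¬ G.Adj u w := by
      intro K hK
      rw [mem_sdiff] at hK
      have hKz : ∀ w ∈ K, ¬ G.Adj z w := fun w hw h =>
        hK.2 (mem_filter.2 ⟨hK.1, w, hw, h⟩)
      have hne : ∀ L ∈ N, L ≠ K := fun L hL h => hK.2 (h ▸ hL)
      constructor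
      · rw [disjoint_insert_left]
        refine ⟨hzC K hK.1, (disjoint_biUnion_left _ _ _).2 fun L hL => ?_⟩
        exact (h3 L (hNC hL) K hK.1 (hne L hL)).1
      · intro u hu w hw
        rcases mem_insert.1 hu with rfl | hu
        · exact hKz w hw
        · obtain ⟨L, hL, hu⟩ := mem_biUnion.1 hu
          exact (h3 L (hNC hL) K hK.1 (hne L hL)).2 u hu w hw
    -- The vertex `z` merges the parts in `N`, and each of them provides at least one new edge.
    refine ⟨insert (insert z (N.biUnion id)) (C \ N), ?_, ?_, ?_, ?_⟩
    · intro K hK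
      rcases mem_insert.1 hK with rfl | hK
      · exact indivisibleOn_insert_biUnion fun K hK => ⟨h1 K (hNC hK), (mem_filter.1 hK).2⟩
      · exact h1 K (mem_sdiff.1 hK).1
    · rw [biUnion_insert, id, insert_union, ← union_biUnion, union_sdiff_of_subset hNC, h2]
    · intro K hK L hL hKL
      rcases mem_insert.1 hK with rfl | hK
      · rcases mem_insert.1 hL with rfl | hL
        · exact absurd rfl hKL
        · exact hout L hL
      · rcases mem_insert.1 hL with rfl | hL
        · exact ⟨(hout K hK).1.symm, fun u hu w hw h => (hout K hK).2 w hw u hu h.symm⟩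
        · exact h3 K (mem_sdiff.1 hK).1 L (mem_sdiff.1 hL).1 hKL
    · have hD : G.degreeSumOn (insert z Z) = G.degreeSumOn Z + 2 * #(G.nbrs Z z) := by
        rw [insert_eq, degreeSumOn_union (by simpa using hz)]
        have : G.degreeSumOn {z} = 0 := by
          simp [degreeSumOn, nbrs, filter_singleton]
        simp [this]
      have hNn : #N ≤ #(G.nbrs Z z) := by
        have := card_le_card_biUnion (s := N) (f := fun K => G.nbrs K z) (by
          intro K hK L hL hKL
          exact (h3 K (hNC hK) L (hNC hL) hKL).1.mono nbrs_subset nbrs_subset) (by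
          intro K hK
          obtain ⟨u, hu, h⟩ := (mem_filter.1 hK).2
          exact ⟨u, mem_nbrs.2 ⟨hu, h⟩⟩)
        refine this.trans (card_le_card (biUnion_subset.2 fun K hK v hv => ?_))
        rw [mem_nbrs] at hv ⊢
        exact ⟨h2 ▸ mem_biUnion.2 ⟨K, hNC hK, hv.1⟩, hv.2⟩
      rw [card_insert_of_notMem hM, card_insert_of_notMem hz, card_sdiff_of_subset hNC, hD]
      have := card_le_card hNC
      omega

/-- If no proper subset of `W` is `3`-connected, then there are fewer than `2 #T' - 3` indivisible
parts of `W \ T` that have all of their neighbours outside in `T'`. -/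
lemma card_parts_le {T : Finset V} {C : Finset (Finset V)}
    (hG : G.TriconnectedOn W) (hmin : ∀ W' ⊆ W, G.TriconnectedOn W' → W' = W)
    (hT : T ⊆ W) (hC : ∀ K ∈ C, G.IndivisibleOn K) (hCT : C.biUnion id = W \ T)
    (hCC : ∀ K ∈ C, ∀ L ∈ C, K ≠ L → Disjoint K L ∧ ∀ u ∈ K, ∀ w ∈ L, ¬ G.Adj u w)
    (h3 : ∀ K ∈ C, ∀ A, (∀ t ∈ T, ∀ u ∈ K, G.Adj u t → t ∈ A) → 3 ≤ #A)
    (n : ℕ) : ∀ T' ⊆ T, #T' = n → 2 ≤ #T' → ∀ D ⊆ C, D ≠ C →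
      (∀ K ∈ D, ∀ t ∈ T, ∀ u ∈ K, G.Adj u t → t ∈ T') → #D + 4 ≤ 2 * #T' := by
  classical
  induction n using Nat.strong_induction_on with
  | _ n ih =>
  intro T' hT' hn h2 D hD hDC hDT
  by_contra! hlt
  obtain ⟨K₀, hK₀, hK₀D⟩ : ∃ K ∈ C, K ∉ D := by
    by_contra! h
    exact hDC (hD.antisymm h)
  have hDne : D.Nonempty := by
    rw [← card_pos]; omega
  have ht3 : 3 ≤ #T' := by
    obtain ⟨K, hK⟩ := hDne
    exact h3 K (hD hK) T' (hDT K hK)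
  have hCsub : ∀ K ∈ C, K ⊆ W \ T := fun K hK v hv => hCT ▸ mem_biUnion.2 ⟨K, hK, hv⟩
  -- `J` misses `K₀`, so it is a proper subset and not 3-connected; only its vertices in `T'` can
  -- have neighbours outside it.
  set J := T' ∪ D.biUnion id with hJ
  have hJW : J ⊆ W := union_subset (hT'.trans hT)
    (biUnion_subset.2 fun K hK => (hCsub K (hD hK)).trans sdiff_subset)
  have hdisj : Disjoint T' (D.biUnion id) := by
    refine (disjoint_biUnion_right _ _ _).2 fun K hK => ?_
    exact (disjoint_sdiff.mono hT' (hCsub K (hD hK)) : _)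
  have hpd : (D : Set (Finset V)).PairwiseDisjoint id := fun K hK L hL hKL =>
    (hCC K (hD hK) L (hD hL) hKL).1
  have hJ4 : 4 ≤ #J := by
    have := card_le_card_biUnion hpd fun K hK => (hC K (hD hK)).1
    rw [hJ, card_union_of_disjoint hdisj]
    omega
  have hJne : J ≠ W := by
    intro h
    obtain ⟨v, hv⟩ := (hC K₀ hK₀).1
    have hvW := mem_sdiff.1 (hCsub K₀ hK₀ hv)
    rw [← h, hJ, mem_union] at hvW
    rcases hvW.1 with h | h
    · exact hvW.2 (hT' h)
    · obtain ⟨K, hK, hvK⟩ := mem_biUnion.1 h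
      exact Finset.disjoint_left.1 (hCC K₀ hK₀ K (hD hK) (by rintro rfl; exact hK₀D hK)).1 hv hvK
  have hclosed : ∀ u ∈ J, u ∉ T' → ∀ w ∈ W, G.Adj u w → w ∈ J := by
    intro u hu huT w hw huw
    rcases mem_union.1 hu with h | h
    · exact absurd h huT
    obtain ⟨K, hK, huK⟩ := mem_biUnion.1 h
    by_cases hwT : w ∈ T
    · exact mem_union_left _ (hDT K hK w hwT u huK huw)
    · have : w ∈ C.biUnion id := hCT ▸ mem_sdiff.2 ⟨hw, hwT⟩
      obtain ⟨L, hL, hwL⟩ := mem_biUnion.1 this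
      by_cases hKL : K = L
      · subst hKL
        exact mem_union_right _ (mem_biUnion.2 ⟨K, hK, hwL⟩)
      · exact absurd huw ((hCC K (hD hK) L hL hKL).2 u huK w hwL)
  obtain ⟨P, hP, Q, hQ, hP', hQ', hPQ, hadj, hX⟩ :=
    not_triconnectedOn (fun h => hJne (hmin J hJW h)) hJ4
  set X := J \ (P ∪ Q) with hXdef
  -- A side that avoids `T'` has no neighbours outside `J`, so the same small set would separate it
  -- in `G`.
  have hmeet : ∀ P Q : Finset V, P ⊆ J → Q ⊆ J → P.Nonempty → Q.Nonempty → Disjoint P Q →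
      (∀ u ∈ P, ∀ w ∈ Q, ¬ G.Adj u w) → #(J \ (P ∪ Q)) ≤ 2 → (T' ∩ P).Nonempty := by
    intro P Q hP hQ hP' hQ' hPQ hadj hX
    by_contra hne
    rw [not_nonempty_iff_eq_empty, ← disjoint_iff_inter_eq_empty] at hne
    refine hG.not_separated (P := P) (Q := W \ (P ∪ (J \ (P ∪ Q)))) (hP.trans hJW)
      sdiff_subset hP' ?_ ?_ ?_ (X := J \ (P ∪ Q)) ?_ hX
    · obtain ⟨q, hq⟩ := hQ'
      refine ⟨q, ?_⟩
      have := hJW (hQ hq)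
      have := Finset.disjoint_right.1 hPQ hq
      simp only [mem_sdiff, mem_union]
      tauto
    · rw [Finset.disjoint_right]
      intro v hv
      simp only [mem_sdiff, mem_union] at hv
      tauto
    · intro u hu w hw huw
      simp only [mem_sdiff, mem_union] at hw
      have := hclosed u (hP hu) (Finset.disjoint_right.1 hne hu) w hw.1 huw
      have := hadj u hu w
      tauto
    · intro v hv
      simp only [mem_sdiff, mem_union]
      tauto
  have hTP := hmeet P Q hP hQ hP' hQ' hPQ hadj hX
  have hTQ := hmeet Q P hQ hP hQ' hP' hPQ.symm (fun u hu w hw h => hadj w hw u hu h.symm)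
    (by rwa [union_comm])
  have hT'J : T' ⊆ J := subset_union_left
  have hcardT : #T' = #(T' ∩ P) + #(T' ∩ Q) + #(T' ∩ X) := by
    have : T' = (T' ∩ P ∪ T' ∩ Q) ∪ T' ∩ X := by
      rw [← inter_union_distrib_left, ← inter_union_distrib_left, hXdef,
        union_sdiff_of_subset (union_subset hP hQ), inter_eq_left.2 hT'J]
    conv_lhs => rw [this]
    rw [card_union_of_disjoint, card_union_of_disjoint]
    · exact hPQ.mono inter_subset_right inter_subset_right
    · rw [← inter_union_distrib_left]
      exact (disjoint_sdiff (s := P ∪ Q) (t := J)).mono inter_subset_right inter_subset_right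
  have hside : ∀ P Q : Finset V, Disjoint P Q → (∀ u ∈ P, ∀ w ∈ Q, ¬ G.Adj u w) →
      J \ (P ∪ Q) = X → (T' ∩ P).Nonempty → (T' ∩ Q).Nonempty →
      #(D.filter (· ⊆ P)) = 0 ∧ #(T' ∩ P) = 1 ∧ #(T' ∩ X) = 0 ∨
      #(D.filter (· ⊆ P)) + 4 ≤ 2 * (#(T' ∩ P) + #(T' ∩ X)) := by
    intro P Q hPQ hadj hX hTP hTQ
    set A := T' ∩ P ∪ T' ∩ X with hA
    have hPX : Disjoint P X := by
      rw [← hX, Finset.disjoint_right]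
      intro v hv
      simp only [mem_sdiff, mem_union] at hv
      tauto
    have hQX : Disjoint Q X := by
      rw [← hX, Finset.disjoint_right]
      intro v hv
      simp only [mem_sdiff, mem_union] at hv
      tauto
    have hAc : #A = #(T' ∩ P) + #(T' ∩ X) :=
      card_union_of_disjoint (hPX.mono inter_subset_right inter_subset_right)
    have hAT : A ⊆ T' := union_subset inter_subset_left inter_subset_left
    have hAQ : #A < #T' := by
      refine card_lt_card ⟨hAT, fun h => ?_⟩
      obtain ⟨q, hq⟩ := hTQ
      rw [mem_inter] at hq
      have := h hq.1
      rw [hA, mem_union, mem_inter, mem_inter] at this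
      rcases this with h | h
      · exact Finset.disjoint_left.1 hPQ h.2 hq.2
      · exact Finset.disjoint_left.1 hQX hq.2 h.2
    have hDA : ∀ K ∈ D.filter (· ⊆ P), ∀ t ∈ T, ∀ u ∈ K, G.Adj u t → t ∈ A := by
      intro K hK t ht u hu hut
      rw [mem_filter] at hK
      have h1 := hDT K hK.1 t ht u hu hut
      have h2 := hadj u (hK.2 hu) t
      have h3 : t ∈ X ↔ t ∈ J ∧ t ∉ P ∪ Q := by rw [← hX]; exact mem_sdiff
      have h4 := hT'J h1
      simp only [hA, mem_union, mem_inter] at h3 ⊢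
      tauto
    -- For `#A ≤ 1` the induction hypothesis does not apply, but a part needs three attachments, so
    -- none lies inside `P`.
    by_cases h2A : 2 ≤ #A
    · right
      rw [← hAc]
      refine ih #A (by omega) A (hAT.trans hT') rfl h2A _ ((filter_subset _ _).trans hD) ?_ hDA
      intro h
      exact hK₀D (filter_subset _ _ (h ▸ hK₀))
    · left
      have := card_pos.2 hTP
      refine ⟨?_, by omega, by omega⟩
      by_contra hne
      obtain ⟨K, hK⟩ := card_pos.1 (Nat.pos_of_ne_zero hne)
      have := h3 K (hD (filter_subset _ _ hK)) A (hDA K hK)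
      omega
  have hsP := hside P Q hPQ hadj hXdef.symm hTP hTQ
  have hsQ := hside Q P hPQ.symm (fun u hu w hw h => hadj w hw u hu h.symm)
    (by rw [union_comm]) hTQ hTP
  -- By indivisibility, a part inside neither side meets `X`; the parts are disjoint from each other
  -- and from `T'`.
  have hDX : #(D.filter fun K => ¬ K ⊆ P ∧ ¬ K ⊆ Q) ≤ #(X \ T') := by
    have := card_le_card_biUnion (s := D.filter fun K => ¬ K ⊆ P ∧ ¬ K ⊆ Q) (f := fun K => K ∩ X)
      (fun K hK L hL hKL => (hpd (filter_subset _ _ hK) (filter_subset _ _ hL) hKL).mono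
        inter_subset_left inter_subset_left) (by
        intro K hK
        rw [mem_filter] at hK
        by_contra hne
        rw [not_nonempty_iff_eq_empty, ← disjoint_iff_inter_eq_empty] at hne
        have := (hC K (hD hK.1)).2 P Q (by
          intro v hv
          have h1 : v ∈ J := mem_union_right _ (mem_biUnion.2 ⟨K, hK.1, hv⟩)
          have h2 := Finset.disjoint_left.1 hne hv
          rw [hXdef, mem_sdiff] at h2
          tauto) hPQ hadj
        tauto)
    refine this.trans (card_le_card (biUnion_subset.2 fun K hK v hv => ?_))
    rw [mem_inter] at hv
    exact mem_sdiff.2 ⟨hv.2, fun h => Finset.disjoint_left.1 hdisj h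
      (mem_biUnion.2 ⟨K, filter_subset _ _ hK, hv.1⟩)⟩
  have hDc : #D ≤ #(D.filter (· ⊆ P)) + #(D.filter (· ⊆ Q)) +
      #(D.filter fun K => ¬ K ⊆ P ∧ ¬ K ⊆ Q) := by
    refine le_trans ?_ ((Nat.add_le_add_right (card_union_le _ _) _).trans' (card_union_le _ _))
    refine card_le_card fun K hK => ?_
    simp only [mem_union, mem_filter]
    tauto
  have hXT : #X = #(T' ∩ X) + #(X \ T') := by
    rw [inter_comm, add_comm, card_sdiff_add_card_inter]
  have := card_pos.2 hTP
  have := card_pos.2 hTQ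
  -- If both sides satisfy the inductive bound, then `#D + 8 ≤ 2 * #T' + #(T' ∩ X) + #X`, where the
  -- last two terms are at most 2 each. A degenerate side holds no part, has one vertex of `T'` and
  -- forces `T' ∩ X` to be empty.
  omega

/-! ### The case of independent vertices of large degree -/

lemma degreeSumOn_eq_of_forall_ne {h : V} (hh : h ∈ W)
    (h3 : ∀ u ∈ W, u ≠ h → #(G.nbrs W u) = 3) :
    G.degreeSumOn W = #(G.nbrs W h) + 3 * (#W - 1) := by
  rw [degreeSumOn, ← add_sum_erase _ _ hh, sum_congr rfl fun u hu => h3 u (mem_of_mem_erase hu)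
    (ne_of_mem_erase hu), sum_const, card_erase_of_mem hh, smul_eq_mul, mul_comm]

lemma nbrs_subset_erase : G.nbrs W u ⊆ W.erase u := fun _ hv =>
  mem_erase.2 ⟨(mem_nbrs.1 hv).2.ne', nbrs_subset hv⟩

lemma HubbedOn.degreeSumOn_add (h : G.HubbedOn W) : G.degreeSumOn W + 4 = 4 * #W := by
  obtain ⟨h, hh, hu⟩ := h
  rw [degreeSumOn_eq_of_forall_ne hh fun u hu' hne => (hu u hu' hne).2]
  have : G.nbrs W h = W.erase h := by
    refine nbrs_subset_erase.antisymm fun v hv => ?_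
    rw [mem_erase] at hv
    exact mem_nbrs.2 ⟨hv.2, (hu v hv.2 hv.1).1⟩
  rw [this, card_erase_of_mem hh]
  have := card_pos.2 ⟨h, hh⟩
  omega

lemma hubbedOn_or_of_forall_ne {h : V} (hh : h ∈ W)
    (h3 : ∀ u ∈ W, u ≠ h → #(G.nbrs W u) = 3) :
    G.HubbedOn W ∨ G.degreeSumOn W + 6 ≤ 4 * #W := by
  have hD := degreeSumOn_eq_of_forall_ne hh h3
  have hsub := nbrs_subset_erase (G := G) (W := W) (u := h)
  have hc := card_erase_of_mem hh
  have hW := card_pos.2 ⟨h, hh⟩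
  by_cases heq : G.nbrs W h = W.erase h
  · left
    refine ⟨h, hh, fun u hu hne => ⟨?_, h3 u hu hne⟩⟩
    exact (mem_nbrs.1 (heq ▸ mem_erase.2 ⟨hne, hu⟩)).2
  · right
    have := card_lt_card (ssubset_of_subset_of_ne hsub heq)
    -- Missing one neighbour only gives `4 * #W - 5`; parity gains the last unit.
    obtain ⟨k, hk⟩ := even_degreeSumOn (G := G) (W := W)
    omega

lemma hubbedOn_or_of_indep (h : G.SuperminimalOn W)
    (hind : ∀ u ∈ W, ∀ w ∈ W, G.Adj u w → #(G.nbrs W u) = 3 ∨ #(G.nbrs W w) = 3) :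
    G.HubbedOn W ∨ G.degreeSumOn W + 6 ≤ 4 * #W := by
  classical
  obtain ⟨hG, hmin⟩ := h
  set T := W.filter fun u => #(G.nbrs W u) ≠ 3 with hTdef
  have hT : T ⊆ W := filter_subset _ _
  have h3 : ∀ u ∈ W, u ∉ T → #(G.nbrs W u) = 3 := by
    intro u hu huT
    by_contra hne
    exact huT (mem_filter.2 ⟨hu, hne⟩)
  rcases Nat.lt_or_ge #T 2 with hT2 | hT2
  · have hWne : W.Nonempty := card_pos.1 (by have := hG.1; omega)
    obtain ⟨h, hh, hTh⟩ : ∃ h ∈ W, T ⊆ {h} := by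
      rcases T.eq_empty_or_nonempty with h | ⟨h, hh⟩
      · obtain ⟨v, hv⟩ := hWne
        exact ⟨v, hv, by simp [h]⟩
      · refine ⟨h, hT hh, fun t ht => ?_⟩
        rw [mem_singleton]
        exact card_le_one.1 (by omega) t ht h hh
    refine hubbedOn_or_of_forall_ne hh fun u hu hne => h3 u hu fun hu' => hne ?_
    simpa using hTh hu'
  right
  have hDT : G.degreeSumOn T = 0 := by
    refine sum_eq_zero fun u hu => ?_
    rw [card_eq_zero, eq_empty_iff_forall_notMem]
    intro w hw
    rw [mem_nbrs] at hw
    have h1 := (mem_filter.1 hu).2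
    have h2 := (mem_filter.1 hw.1).2
    have := hind u (hT hu) w (hT hw.1) hw.2
    tauto
  obtain ⟨Z, hZ⟩ : ∃ Z, Z = W \ T := ⟨_, rfl⟩
  have hZW : Z ⊆ W := hZ ▸ sdiff_subset
  have hdis : Disjoint Z T := hZ ▸ sdiff_disjoint
  have hWZT : W = Z ∪ T := by rw [hZ, sdiff_union_of_subset hT]
  have hcard : #W = #Z + #T := by rw [hWZT, card_union_of_disjoint hdis]
  have hD : G.degreeSumOn W + G.degreeSumOn Z = 6 * #Z := by
    have h1 : G.degreeSumOn W = G.degreeSumOn Z + G.degreeSumOn T +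
        2 * ∑ u ∈ Z, #(G.nbrs T u) := by
      rw [← degreeSumOn_union hdis, ← hWZT]
    have h2 : ∑ u ∈ Z, #(G.nbrs W u) = G.degreeSumOn Z + ∑ u ∈ Z, #(G.nbrs T u) := by
      rw [degreeSumOn, ← sum_add_distrib]
      refine sum_congr rfl fun u _ => ?_
      rw [← card_nbrs_union hdis, ← hWZT]
    rw [sum_congr rfl fun u hu => h3 u (mem_sdiff.1 (hZ ▸ hu)).1 (mem_sdiff.1 (hZ ▸ hu)).2, sum_const,
      smul_eq_mul] at h2
    omega
  obtain ⟨C, hC, hCT, hCC, hCcard⟩ := exists_components G Z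
  -- The degree sum is `6 * #Z - D(Z) ≤ 4 * #Z + 2 * #C`, and `#Z = #W - #T`.
  suffices hkey : #C + 3 ≤ 2 * #T by omega
  rcases C.eq_empty_or_nonempty with hCe | ⟨K₀, hK₀⟩
  · simp only [hCe, card_empty]
    omega
  have hCsub : ∀ K ∈ C, K ⊆ Z := fun K hK v hv => hCT ▸ mem_biUnion.2 ⟨K, hK, hv⟩
  -- Three vertices in `T` ensure that fewer than three attachments of a part leave a vertex of `T`
  -- to be separated from it.
  rcases Nat.lt_or_ge 2 #T with hT3 | hT2'
  · have hN : ∀ K ∈ C, ∀ A, (∀ t ∈ T, ∀ u ∈ K, G.Adj u t → t ∈ A) → 3 ≤ #A := by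
      intro K hK A hA
      by_contra! hlt
      obtain ⟨t, ht, htA⟩ : ∃ t ∈ T, t ∉ A := by
        by_contra! h
        have := card_le_card h
        omega
      have hKZ := hCsub K hK
      refine hG.not_separated (P := K) (Q := W \ (K ∪ A)) (X := A) (hKZ.trans hZW)
        sdiff_subset (hC K hK).1 ⟨t, ?_⟩ ?_ ?_ ?_ (by omega)
      · have := Finset.disjoint_right.1 hdis ht
        rw [mem_sdiff, mem_union]
        exact ⟨hT ht, fun h => h.elim (fun h => this (hKZ h)) htA⟩
      · rw [Finset.disjoint_right]
        intro v hv
        simp only [mem_sdiff, mem_union] at hv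
        tauto
      · intro u hu w hw huw
        simp only [mem_sdiff, mem_union, not_or] at hw
        by_cases hwT : w ∈ T
        · exact hw.2.2 (hA w hwT u hu huw)
        · have : w ∈ C.biUnion id := by rw [hCT, hZ]; exact mem_sdiff.2 ⟨hw.1, hwT⟩
          obtain ⟨L, hL, hwL⟩ := mem_biUnion.1 this
          refine (hCC K hK L hL ?_).2 u hu w hwL huw
          rintro rfl
          exact hw.2.1 hwL
      · intro v hv
        simp only [mem_union, mem_sdiff]
        tauto
    -- The bound is for proper subfamilies, so one part is left out; this costs one unit.
    have := card_parts_le hG (fun W' hW' h => (hmin W' hW' G le_rfl h).1) hT hC (hZ ▸ hCT) hCC hN #T T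
      Subset.rfl rfl hT2 (C.erase K₀) (erase_subset _ _)
      (fun h => notMem_erase K₀ C (h.symm ▸ hK₀)) (fun _ _ t ht _ _ _ => ht)
    rw [card_erase_of_mem hK₀] at this
    omega
  · have : #C ≤ 1 := by
      refine card_le_one.2 fun K hK L hL => ?_
      by_contra hKL
      have hd := hCC K hK L hL hKL
      refine hG.not_separated (P := K) (Q := Z \ K) (X := T) ((hCsub K hK).trans hZW)
        (sdiff_subset.trans hZW) (hC K hK).1 ?_ disjoint_sdiff ?_ ?_ hT2'
      · obtain ⟨v, hv⟩ := (hC L hL).1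
        exact ⟨v, mem_sdiff.2 ⟨hCsub L hL hv, Finset.disjoint_right.1 hd.1 hv⟩⟩
      · intro u hu w hw huw
        rw [mem_sdiff] at hw
        have : w ∈ C.biUnion id := hCT ▸ hw.1
        obtain ⟨M, hM, hwM⟩ := mem_biUnion.1 this
        refine (hCC K hK M hM ?_).2 u hu w hwM huw
        rintro rfl
        exact hw.2 hwM
      · intro v hv
        simp only [hZ, mem_union, mem_sdiff]
        tauto
    omega

/-! ### Ports and side graphs -/

/-- Two finite sets, whose union is the vertex set in question, are joined by three ports: the
`i`-th port is either a common vertex `α i = β i` of both sets, or it consists of a vertex `α i` of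
`L \ R` and a vertex `β i` of `R \ L`. All common vertices are ports, and the port `0` is of the
second kind. -/
structure Ported (L R : Finset V) (α β : Fin 3 → V) : Prop where
  inj_left : Function.Injective α
  inj_right : Function.Injective β
  mem_left : ∀ i, α i ∈ L
  mem_right : ∀ i, β i ∈ R
  eq_of_left_mem : ∀ i, α i ∈ R → α i = β i
  eq_of_right_mem : ∀ i, β i ∈ L → α i = β i
  exists_of_mem : ∀ v ∈ L, v ∈ R → ∃ i, α i = v ∧ β i = v
  ne_zero : α 0 ≠ β 0

lemma Ported.symm (h : Ported L R α β) : Ported R L β α where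
  inj_left := h.inj_right
  inj_right := h.inj_left
  mem_left := h.mem_right
  mem_right := h.mem_left
  eq_of_left_mem i hi := (h.eq_of_right_mem i hi).symm
  eq_of_right_mem i hi := (h.eq_of_left_mem i hi).symm
  exists_of_mem v hv hv' := (h.exists_of_mem v hv' hv).imp fun _ => And.symm
  ne_zero := h.ne_zero.symm

lemma Ported.zero_notMem_right (h : Ported L R α β) : α 0 ∉ R := fun hm =>
  h.ne_zero (h.eq_of_left_mem 0 hm)

lemma Ported.zero_notMem_left (h : Ported L R α β) : β 0 ∉ L := fun hm =>
  h.ne_zero (h.eq_of_right_mem 0 hm)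

/-- The edges of `G` between `L \ R` and `R \ L` are exactly those of the ports. -/
structure LinkedBy (G : SimpleGraph V) (L R : Finset V) (α β : Fin 3 → V) : Prop
    extends Ported L R α β where
  adj : ∀ i, α i ≠ β i → G.Adj (α i) (β i)
  exists_of_adj : ∀ u ∈ L, u ∉ R → ∀ w ∈ R, w ∉ L → G.Adj u w → ∃ i, u = α i ∧ w = β i

lemma LinkedBy.symm (h : G.LinkedBy L R α β) : G.LinkedBy R L β α where
  toPorted := h.toPorted.symm
  adj i hi := (h.adj i hi.symm).symm
  exists_of_adj u hu hu' w hw hw' huw :=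
    (h.exists_of_adj w hw hw' u hu hu' huw.symm).imp fun _ => And.symm

/-- The graph on `L` and a further vertex `y` that has the edges of `G` within `L`, except for
those within `L ∩ R`, and the edges from `y` to the vertices `α i`. -/
def sideGraph (G : SimpleGraph V) (L R : Finset V) (α : Fin 3 → V) (y : V) : SimpleGraph V where
  Adj u w := G.Adj u w ∧ (u ∈ L ∧ w ∈ L) ∧ ¬ (u ∈ R ∧ w ∈ R) ∨
    u ≠ w ∧ (u = y ∧ (∃ i, w = α i) ∨ w = y ∧ ∃ i, u = α i)
  symm := ⟨by
    rintro u w (⟨h1, h2, h3⟩ | ⟨h1, h2⟩)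
    · exact Or.inl ⟨h1.symm, h2.symm, fun h => h3 h.symm⟩
    · exact Or.inr ⟨h1.symm, h2.symm⟩⟩
  loopless := ⟨by
    rintro u (h | h)
    · exact G.irrefl h.1
    · exact h.1 rfl⟩

lemma sideGraph_adj_of_mem (hy : y ∉ L) (hu : u ∈ L) (hw : w ∈ L) :
    (G.sideGraph L R α y).Adj u w ↔ G.Adj u w ∧ ¬ (u ∈ R ∧ w ∈ R) := by
  have h1 : u ≠ y := by rintro rfl; exact hy hu
  have h2 : w ≠ y := by rintro rfl; exact hy hw
  simp [sideGraph, hu, hw, h1, h2]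

lemma sideGraph_adj_fresh (hα : ∀ i, α i ∈ L) (hy : y ∉ L) :
    (G.sideGraph L R α y).Adj y w ↔ ∃ i, w = α i := by
  have h : (∃ i, w = α i) → y ≠ w := by
    rintro ⟨i, rfl⟩ rfl
    exact hy (hα i)
  have h' : ¬ ∃ i, y = α i := by
    rintro ⟨i, rfl⟩
    exact hy (hα i)
  simp only [sideGraph, hy, false_and, and_false, true_and, false_or, h', or_false]
  tauto

/-- A small separation of the side graph lifts to `G`. If `y` lies on one side, `R \ L` is added to
that side. If `y` is removed, one of the two sides contains at most one port, and removing this port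
instead of `y` cuts off the rest of that side; if nothing else is there, the port has too few
neighbours. -/
lemma LinkedBy.triconnectedOn_sideGraph (h : G.LinkedBy L R α β) (hG : G.TriconnectedOn (L ∪ R))
    (h2 : ∀ i, α i = β i → 2 ≤ #(G.nbrs (L \ R) (α i))) (hyL : y ∉ L) (hyR : y ∈ R) :
    (G.sideGraph L R α y).TriconnectedOn (insert y L) := by
  constructor
  · have := card_le_card (image_subset_iff.2 fun i _ => h.mem_left i : univ.image α ⊆ L)
    rw [card_image_of_injective _ h.inj_left, card_univ, Fintype.card_fin] at this
    rw [card_insert_of_notMem hyL]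
    omega
  have haux : ∀ P Q : Finset V, P ⊆ insert y L → Q ⊆ insert y L → P.Nonempty → Q.Nonempty →
      Disjoint P Q → (∀ u ∈ P, ∀ w ∈ Q, ¬ (G.sideGraph L R α y).Adj u w) →
      #(insert y L \ (P ∪ Q)) ≤ 2 → y ∈ P → False := by
    intro P Q hP hQ hP' hQ' hPQ hadj hX hyP
    have hyQ : y ∉ Q := Finset.disjoint_left.1 hPQ hyP
    have hQL : ∀ w ∈ Q, w ∈ L := fun w hw =>
      (mem_insert.1 (hQ hw)).resolve_left (by rintro rfl; exact hyQ hw)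
    have hαQ : ∀ i, α i ∉ Q := fun i hi =>
      hadj y hyP _ hi ((sideGraph_adj_fresh h.mem_left hyL).2 ⟨i, rfl⟩)
    have hQR : ∀ w ∈ Q, w ∉ R := by
      intro w hw hwR
      obtain ⟨i, rfl, -⟩ := h.exists_of_mem w (hQL w hw) hwR
      exact hαQ i hw
    refine hG.not_separated (P := P ∪ (R \ L)) (Q := Q) (X := insert y L \ (P ∪ Q))
      ?_ ?_ (hP'.mono subset_union_left) hQ' ?_ ?_ ?_ hX
    · intro v hv
      have := @hP v
      simp only [mem_union, mem_sdiff, mem_insert] at *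
      rcases hv with hv | hv
      · rcases this hv with rfl | h
        · exact Or.inr hyR
        · exact Or.inl h
      · exact Or.inr hv.1
    · exact fun w hw => mem_union_left _ (hQL w hw)
    · rw [Finset.disjoint_right]
      intro w hw
      have h1 := Finset.disjoint_right.1 hPQ hw
      have h2 := hQL w hw
      simp only [mem_union, mem_sdiff]
      tauto
    · intro u hu w hw huw
      by_cases huL : u ∈ L
      · have huP : u ∈ P := by
          simp only [mem_union, mem_sdiff] at hu
          tauto
        exact hadj u huP w hw ((sideGraph_adj_of_mem hyL huL (hQL w hw)).2
          ⟨huw, fun h => hQR w hw h.2⟩)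
      · have huR : u ∈ R := by
          simp only [mem_union, mem_sdiff] at hu
          rcases hu with hu | hu
          · rcases mem_insert.1 (hP hu) with rfl | hu
            · exact hyR
            · exact absurd hu huL
          · exact hu.1
        obtain ⟨i, rfl, -⟩ := h.exists_of_adj w (hQL w hw) (hQR w hw) u huR huL huw.symm
        exact hαQ i hw
    · intro v hv
      simp only [mem_union, mem_sdiff, mem_insert] at *
      tauto
  have haux' : ∀ P Q : Finset V, P ⊆ L → Q ⊆ L → P.Nonempty → Q.Nonempty →
      Disjoint P Q → (∀ u ∈ P, ∀ w ∈ Q, ¬ (G.sideGraph L R α y).Adj u w) →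
      #(L \ (P ∪ Q)) ≤ 1 → (∃ j, ∀ i, α i ∈ P → i = j) → False := by
    rintro P Q hP hQ ⟨p, hp⟩ hQ' hPQ hadj hX ⟨j, hj⟩
    have hLadj : ∀ u ∈ P, ∀ w ∈ L, G.Adj u w → ¬ (u ∈ R ∧ w ∈ R) → w ∉ P →
        w ∈ L \ (P ∪ Q) := by
      intro u hu w hw huw hR hwP
      have := fun hwQ => hadj u hu w hwQ ((sideGraph_adj_of_mem hyL (hP hu) hw).2 ⟨huw, hR⟩)
      simp only [mem_sdiff, mem_union]
      tauto
    by_cases hPj : (P.erase (α j)).Nonempty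
    · refine hG.not_separated (P := P.erase (α j))
        (Q := (L ∪ R) \ (P.erase (α j) ∪ insert (α j) (L \ (P ∪ Q))))
        (X := insert (α j) (L \ (P ∪ Q))) ?_ sdiff_subset hPj ⟨y, ?_⟩ ?_ ?_ ?_ ?_
      · exact (erase_subset _ _).trans (hP.trans subset_union_left)
      · have h1 : y ∉ P := fun h => hyL (hP h)
        have h2 : y ≠ α j := by rintro rfl; exact hyL (h.mem_left j)
        simp [hyL, hyR, h1, h2]
      · rw [Finset.disjoint_right]
        intro v hv
        simp only [mem_sdiff, mem_union] at hv
        tauto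
      · intro u hu w hw huw
        rw [mem_erase] at hu
        simp only [mem_sdiff, mem_union, mem_erase, mem_insert, not_or, not_and] at hw
        have huα : ∀ i, u ≠ α i := by
          rintro i rfl
          exact hu.1 (by rw [hj i hu.2])
        have huR : u ∉ R := by
          intro huR
          obtain ⟨i, hi, -⟩ := h.exists_of_mem u (hP hu.2) huR
          exact huα i hi.symm
        by_cases hwL : w ∈ L
        · have := hLadj u hu.2 w hwL huw (fun h => huR h.1) (fun h => hw.2.1 hw.2.2.1 h)
          simp only [mem_sdiff, mem_union] at this
          tauto
        · obtain ⟨i, hi, -⟩ := h.exists_of_adj u (hP hu.2) huR w (by tauto) hwL huw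
          exact huα i hi
      · intro v hv
        simp only [mem_sdiff, mem_union, mem_erase, mem_insert] at *
        tauto
      · exact (card_insert_le _ _).trans (by omega)
    · rw [not_nonempty_iff_eq_empty] at hPj
      have hPeq : ∀ u ∈ P, u = α j := by
        intro u hu
        by_contra hne
        exact notMem_empty u (hPj ▸ mem_erase.2 ⟨hne, hu⟩)
      obtain rfl := hPeq p hp
      by_cases hjR : α j ∈ R
      · have h2j := h2 j (h.eq_of_left_mem j hjR)
        have : G.nbrs (L \ R) (α j) ⊆ L \ (P ∪ Q) := by
          intro w hw
          rw [mem_nbrs, mem_sdiff] at hw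
          exact hLadj _ hp w hw.1.1 hw.2 (fun h => hw.1.2 h.2)
            fun hwP => hw.2.ne (hPeq w hwP).symm
        have := card_le_card this
        omega
      · have h3 := hG.three_le_card_nbrs (mem_union_left R (h.mem_left j))
        have : G.nbrs (L ∪ R) (α j) ⊆ insert (β j) (L \ (P ∪ Q)) := by
          intro w hw
          rw [mem_nbrs, mem_union] at hw
          by_cases hwL : w ∈ L
          · exact mem_insert_of_mem (hLadj _ hp w hwL hw.2 (fun h => hjR h.1)
              fun hwP => hw.2.ne (hPeq w hwP).symm)
          · obtain ⟨i, hi, rfl⟩ := h.exists_of_adj _ (hP hp) hjR w (by tauto) hwL hw.2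
            rw [h.inj_left hi]
            exact mem_insert_self _ _
        have := card_le_card this
        have := card_insert_le (β j) (L \ (P ∪ Q))
        omega
  intro P hP Q hQ hP' hQ' hPQ hadj
  by_contra! hX
  have hadj' : ∀ u ∈ Q, ∀ w ∈ P, ¬ (G.sideGraph L R α y).Adj u w :=
    fun u hu w hw h => hadj w hw u hu h.symm
  by_cases hyP : y ∈ P
  · exact haux P Q hP hQ hP' hQ' hPQ hadj (by omega) hyP
  by_cases hyQ : y ∈ Q
  · exact haux Q P hQ hP hQ' hP' hPQ.symm hadj' (by rw [union_comm]; omega) hyQ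
  have hPL : P ⊆ L := fun u hu => (mem_insert.1 (hP hu)).resolve_left (by rintro rfl; exact hyP hu)
  have hQL : Q ⊆ L := fun u hu => (mem_insert.1 (hQ hu)).resolve_left (by rintro rfl; exact hyQ hu)
  have hX1 : #(L \ (P ∪ Q)) ≤ 1 := by
    rw [insert_sdiff_of_notMem _ (by simp [hyP, hyQ]), card_insert_of_notMem (by simp [hyL])] at hX
    omega
  by_cases hone : ∃ j, ∀ i, α i ∈ P → i = j
  · exact haux' P Q hPL hQL hP' hQ' hPQ hadj hX1 hone
  -- Two of the three ports lie in `P`, so at most one lies in `Q`.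
  refine haux' Q P hQL hPL hQ' hP' hPQ.symm hadj' (by rwa [union_comm]) ?_
  have hPQi : ∀ i, α i ∈ P → α i ∉ Q := fun i hi => Finset.disjoint_left.1 hPQ hi
  push Not at hone
  obtain ⟨i, hiP, -⟩ := hone 0
  obtain ⟨k, hkP, hki⟩ := hone i
  have h1 := hPQi i hiP
  have h2 := hPQi k hkP
  by_contra! hcon
  obtain ⟨a, ha, -⟩ := hcon 0
  obtain ⟨b, hb, hba⟩ := hcon a
  have e1 : i ≠ a := by rintro rfl; exact h1 ha
  have e2 : i ≠ b := by rintro rfl; exact h1 hb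
  have e3 : k ≠ a := by rintro rfl; exact h2 ha
  have e4 : k ≠ b := by rintro rfl; exact h2 hb
  omega

/-! ### Gluing along ports -/

/-- Without `x`, the graph `B` still cannot be separated by a single vertex. -/
lemma TriconnectedOn.inter_eq_empty (hB : B.TriconnectedOn (insert x R)) (hPQ : Disjoint P Q)
    (hadj : ∀ u ∈ P, ∀ w ∈ Q, u ∈ R → w ∈ R → ¬ B.Adj u w) (hX : #(R \ (P ∪ Q)) ≤ 1) :
    P ∩ R = ∅ ∨ Q ∩ R = ∅ := by
  by_contra! hne
  refine hB.not_separated (P := P ∩ R) (Q := Q ∩ R) (X := insert x (R \ (P ∪ Q)))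
    (inter_subset_right.trans (subset_insert _ _)) (inter_subset_right.trans (subset_insert _ _))
    hne.1 hne.2 (hPQ.mono inter_subset_left inter_subset_left) ?_ ?_
    ((card_insert_le _ _).trans (by omega))
  · intro u hu w hw
    rw [mem_inter] at hu hw
    exact hadj u hu.1 w hw.1 hu.2 hw.2
  · intro v hv
    simp only [mem_union, mem_inter, mem_insert, mem_sdiff] at *
    tauto

/-- The vertex `y` can be put on the side of `P`: if it had a neighbour `α i` in `Q`, then `β i`
would be a removed vertex, hence in `L`, and so equal to `α i`, which is not in `R`. -/
lemma Ported.not_separated_of_subset_left (h : Ported L R α β) (hA : A.TriconnectedOn (insert y L))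
    (hyL : y ∉ L) (hAy : ∀ w ∈ L, A.Adj y w → ∃ i, w = α i)
    (hAK : ∀ u ∈ L, ∀ w ∈ L, A.Adj u w → K.Adj u w) (hK : ∀ i, α i ≠ β i → K.Adj (α i) (β i))
    (hPQ : Disjoint P Q) (hQ : Q.Nonempty) (hQL : Q ⊆ L) (hQR : Q ∩ R = ∅)
    (hadj : ∀ u ∈ P, ∀ w ∈ Q, ¬ K.Adj u w) (hX : #((L ∪ R) \ (P ∪ Q)) ≤ 2)
    (hXL : (L ∪ R) \ (P ∪ Q) ⊆ L) : False := by
  have hQR' : ∀ w ∈ Q, w ∉ R := fun w hw hwR =>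
    notMem_empty w (hQR ▸ mem_inter.2 ⟨hw, hwR⟩)
  refine hA.not_separated (P := insert y (P ∩ L)) (Q := Q) (X := (L ∪ R) \ (P ∪ Q))
    (insert_subset_insert _ inter_subset_right) (hQL.trans (subset_insert _ _))
    (insert_nonempty _ _) hQ ?_ ?_ ?_ hX
  · rw [disjoint_insert_left]
    exact ⟨fun hy => hyL (hQL hy), hPQ.mono_left inter_subset_left⟩
  · intro u hu w hw huw
    rcases mem_insert.1 hu with rfl | hu
    · obtain ⟨i, rfl⟩ := hAy w (hQL hw) huw
      have hne : α i ≠ β i := fun he => hQR' _ hw (he ▸ h.mem_right i)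
      have hβQ : β i ∉ Q := fun hβ => hQR' _ hβ (h.mem_right i)
      have hβP : β i ∉ P := fun hβ => hadj _ hβ _ hw (hK i hne).symm
      refine hne (h.eq_of_right_mem i (hXL ?_))
      simp [h.mem_right i, hβQ, hβP]
    · rw [mem_inter] at hu
      exact hadj u hu.1 w hw (hAK u hu.2 w (hQL hw) huw)
  · intro v hv
    simp only [mem_union, mem_inter, mem_insert, mem_sdiff] at *
    tauto

lemma Ported.not_separated_of_sdiff_subset (h : Ported L R α β)
    (hA : A.TriconnectedOn (insert y L))
    (hyL : y ∉ L) (hAy : ∀ w ∈ L, A.Adj y w → ∃ i, w = α i)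
    (hAK : ∀ u ∈ L, ∀ w ∈ L, A.Adj u w → K.Adj u w) (hK : ∀ i, α i ≠ β i → K.Adj (α i) (β i))
    (hB : B.TriconnectedOn (insert x R))
    (hxR : x ∉ R) (hBx : ∀ w ∈ R, B.Adj x w → ∃ i, w = β i)
    (hBK : ∀ u ∈ R, ∀ w ∈ R, B.Adj u w → K.Adj u w)
    (hP : P ⊆ L ∪ R) (hQ : Q ⊆ L ∪ R) (hP' : P.Nonempty) (hQ' : Q.Nonempty)
    (hPQ : Disjoint P Q) (hadj : ∀ u ∈ P, ∀ w ∈ Q, ¬ K.Adj u w)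
    (hX : #((L ∪ R) \ (P ∪ Q)) ≤ 2) (hXL : (L ∪ R) \ (P ∪ Q) ⊆ L) : False := by
  have hadj' : ∀ u ∈ Q, ∀ w ∈ P, ¬ K.Adj u w := fun u hu w hw h => hadj w hw u hu h.symm
  have hsub : ∀ {P : Finset V}, P ⊆ L ∪ R → P ∩ R = ∅ → P ⊆ L := by
    intro P hP hPR v hv
    refine (mem_union.1 (hP hv)).resolve_right fun hvR => ?_
    exact notMem_empty v (hPR ▸ mem_inter.2 ⟨hv, hvR⟩)
  have hfin : ¬ (P ∩ R = ∅ ∨ Q ∩ R = ∅) := by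
    rintro (hR | hR)
    · exact h.not_separated_of_subset_left hA hyL hAy hAK hK hPQ.symm hP' (hsub hP hR) hR
        hadj' (by rwa [union_comm Q]) (by rwa [union_comm Q])
    · exact h.not_separated_of_subset_left hA hyL hAy hAK hK hPQ hQ' (hsub hQ hR) hR hadj hX hXL
  by_cases hXR : #(R \ (P ∪ Q)) ≤ 1
  · exact hfin (hB.inter_eq_empty hPQ
      (fun u hu w hw huR hwR huw => hadj u hu w hw (hBK u huR w hwR huw)) hXR)
  have hsubX : R \ (P ∪ Q) ⊆ (L ∪ R) \ (P ∪ Q) := sdiff_subset_sdiff subset_union_right Subset.rfl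
  have hXeq : R \ (P ∪ Q) = (L ∪ R) \ (P ∪ Q) := eq_of_subset_of_card_le hsubX (by omega)
  -- both remaining vertices are ports of index `1` and `2`
  have hports : ∀ i, i ≠ 0 → β i ∉ P ∪ Q := by
    have hsubI : R \ (P ∪ Q) ⊆ ({1, 2} : Finset (Fin 3)).image β := by
      intro v hv
      have hvL : v ∈ L := hXL (hXeq ▸ hv)
      obtain ⟨i, hi, hi'⟩ := h.exists_of_mem v hvL (mem_sdiff.1 hv).1
      have : i ≠ 0 := by
        rintro rfl
        exact h.ne_zero (hi.trans hi'.symm)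
      refine mem_image.2 ⟨i, ?_, hi'⟩
      fin_cases i <;> simp at *
    have hIeq := eq_of_subset_of_card_le hsubI (card_image_le.trans (by
      have : #({1, 2} : Finset (Fin 3)) = 2 := by decide
      omega))
    intro i hi
    have : β i ∈ R \ (P ∪ Q) := by
      rw [hIeq]
      refine mem_image_of_mem _ ?_
      fin_cases i <;> simp at *
    exact (mem_sdiff.1 this).2
  -- With ports `1` and `2` removed, `β 0` is the only possible remaining neighbour of `x`, so `x`
  -- can join a side whose opposite does not contain `β 0`.
  have hone : ∀ {P Q : Finset V}, Disjoint P Q → (∀ u ∈ P, ∀ w ∈ Q, ¬ K.Adj u w) →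
      (∀ i, i ≠ 0 → β i ∉ P ∪ Q) → #(R \ (P ∪ Q)) ≤ 2 → β 0 ∉ Q → Q ∩ R = ∅ := by
    intro P Q hPQ hadj hports hX h0
    by_contra hne
    refine hB.not_separated (P := insert x (P ∩ R)) (Q := Q ∩ R) (X := R \ (P ∪ Q))
      (insert_subset_insert _ inter_subset_right) (inter_subset_right.trans (subset_insert _ _))
      (insert_nonempty _ _) (nonempty_iff_ne_empty.2 hne) ?_ ?_ ?_ hX
    · rw [disjoint_insert_left]
      exact ⟨fun hx => hxR (mem_inter.1 hx).2, hPQ.mono inter_subset_left inter_subset_left⟩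
    · intro u hu w hw huw
      rw [mem_inter] at hw
      rcases mem_insert.1 hu with rfl | hu
      · obtain ⟨i, rfl⟩ := hBx w hw.2 huw
        by_cases hi : i = 0
        · subst hi
          exact h0 hw.1
        · exact hports i hi (mem_union_right _ hw.1)
      · rw [mem_inter] at hu
        exact hadj u hu.1 w hw.1 (hBK u hu.2 w hw.2 huw)
    · intro v hv
      simp only [mem_union, mem_inter, mem_insert, mem_sdiff] at *
      tauto
  have hXR2 := (card_le_card hsubX).trans hX
  by_cases h0 : β 0 ∈ Q
  · exact hfin (Or.inl (hone hPQ.symm hadj' (by simpa [and_comm] using hports)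
      (by rwa [union_comm Q]) (Finset.disjoint_right.1 hPQ h0)))
  · exact hfin (Or.inr (hone hPQ hadj hports hXR2 h0))

/-- Two `3`-connected graphs, each with a vertex of degree `3` removed, glued along the three
ports. -/
lemma Ported.triconnectedOn_glue (h : Ported L R α β)
    (hA : A.TriconnectedOn (insert y L))
    (hyL : y ∉ L) (hAy : ∀ w ∈ L, A.Adj y w → ∃ i, w = α i)
    (hAK : ∀ u ∈ L, ∀ w ∈ L, A.Adj u w → K.Adj u w)
    (hB : B.TriconnectedOn (insert x R))
    (hxR : x ∉ R) (hBx : ∀ w ∈ R, B.Adj x w → ∃ i, w = β i)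
    (hBK : ∀ u ∈ R, ∀ w ∈ R, B.Adj u w → K.Adj u w)
    (hK : ∀ i, α i ≠ β i → K.Adj (α i) (β i)) : K.TriconnectedOn (L ∪ R) := by
  constructor
  · have h1 := hA.1
    rw [card_insert_of_notMem hyL] at h1
    have h2 : #(insert (β 0) L) ≤ #(L ∪ R) := card_le_card (insert_subset
      (mem_union_right _ (h.mem_right 0)) subset_union_left)
    rw [card_insert_of_notMem h.zero_notMem_left] at h2
    omega
  intro P hP Q hQ hP' hQ' hPQ hadj
  by_contra! hX
  have hX2 : #((L ∪ R) \ (P ∪ Q)) ≤ 2 := by omega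
  by_cases hXL : (L ∪ R) \ (P ∪ Q) ⊆ L
  · exact h.not_separated_of_sdiff_subset hA hyL hAy hAK hK hB hxR hBx hBK hP hQ hP' hQ' hPQ hadj
      hX2 hXL
  by_cases hXR : (L ∪ R) \ (P ∪ Q) ⊆ R
  · refine h.symm.not_separated_of_sdiff_subset hB hxR hBx hBK (fun i hi => (hK i hi.symm).symm)
      hA hyL hAy hAK (P := P) (Q := Q) ?_ ?_ hP' hQ' hPQ hadj ?_ ?_ <;> rwa [union_comm R]
  -- In the remaining case one vertex is removed from each of `L \ R` and `R \ L`. What is left of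
  -- `L` lies on one side, as does what is left of `R`, and one of the three ports avoids both
  -- removed vertices and ties them together.
  obtain ⟨q, hq, hqL⟩ := not_subset.1 hXL
  obtain ⟨p, hp, hpR⟩ := not_subset.1 hXR
  have hqp : p ≠ q := by
    rintro rfl
    have := mem_union.1 (mem_sdiff.1 hp).1
    tauto
  have hXpq : (L ∪ R) \ (P ∪ Q) = {p, q} := by
    refine (eq_of_subset_of_card_le (insert_subset hp (singleton_subset_iff.2 hq)) ?_).symm
    rw [card_pair hqp]
    exact hX2
  have hmem : ∀ v, v ∈ L ∪ R → v ∈ P ∨ v ∈ Q ∨ v = p ∨ v = q := by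
    intro v hv
    have := Finset.ext_iff.1 hXpq v
    simp only [mem_sdiff, mem_insert, mem_singleton] at this
    rw [mem_union (s := P)] at this
    tauto
  have hL1 : #(L \ (P ∪ Q)) ≤ 1 := by
    rw [← card_singleton p]
    refine card_le_card fun v hv => ?_
    rw [mem_sdiff, mem_union, not_or] at hv
    rcases hmem v (mem_union_left _ hv.1) with h | h | h | h
    · tauto
    · tauto
    · exact mem_singleton.2 h
    · exact absurd (h ▸ hv.1) hqL
  have hR1 : #(R \ (P ∪ Q)) ≤ 1 := by
    rw [← card_singleton q]
    refine card_le_card fun v hv => ?_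
    rw [mem_sdiff, mem_union, not_or] at hv
    rcases hmem v (mem_union_right _ hv.1) with h | h | h | h
    · tauto
    · tauto
    · exact absurd (h ▸ hv.1) hpR
    · exact mem_singleton.2 h
  have hLe := hA.inter_eq_empty hPQ
    (fun u hu w hw huL hwL huw => hadj u hu w hw (hAK u huL w hwL huw)) hL1
  have hRe := hB.inter_eq_empty hPQ
    (fun u hu w hw huR hwR huw => hadj u hu w hw (hBK u huR w hwR huw)) hR1
  obtain ⟨i, hip, hiq⟩ : ∃ i, α i ≠ p ∧ β i ≠ q := by
    by_contra! hcon
    have hinjl := h.inj_left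
    have hinjr := h.inj_right
    have key : ∀ i j, i ≠ j → α i = p → α j ≠ p := fun i j hij hi hj =>
      hij (hinjl (hi.trans hj.symm))
    have key' : ∀ i j, i ≠ j → β i = q → β j ≠ q := fun i j hij hi hj =>
      hij (hinjr (hi.trans hj.symm))
    by_cases h0 : α 0 = p
    · exact key' 1 2 (by decide) (hcon 1 (key 0 1 (by decide) h0))
        (hcon 2 (key 0 2 (by decide) h0))
    · have := hcon 0 h0
      have h1 : α 1 = p := by
        by_contra h1
        exact key' 0 1 (by decide) this (hcon 1 h1)
      exact key' 0 2 (by decide) this (hcon 2 (key 1 2 (by decide) h1))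
  have hαL := h.mem_left i
  have hβR := h.mem_right i
  have hα : α i ∈ P ∨ α i ∈ Q := by
    have hαq : α i ≠ q := fun he => hqL (he ▸ hαL)
    rcases hmem _ (mem_union_left _ hαL) with h | h | h | h
    exacts [Or.inl h, Or.inr h, absurd h hip, absurd h hαq]
  have hβ : β i ∈ P ∨ β i ∈ Q := by
    have hβp : β i ≠ p := fun he => hpR (he ▸ hβR)
    rcases hmem _ (mem_union_right _ hβR) with h | h | h | h
    exacts [Or.inl h, Or.inr h, absurd h hβp, absurd h hiq]
  have hemp : ∀ {S T : Finset V} {v : V}, S ∩ T = ∅ → v ∈ T → v ∉ S := fun hST hvT hvS =>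
    notMem_empty _ (hST ▸ mem_inter.2 ⟨hvS, hvT⟩)
  obtain ⟨s, hs⟩ := hP'
  obtain ⟨t, ht⟩ := hQ'
  have hdisj : ∀ v ∈ P, v ∉ Q := fun v hv => Finset.disjoint_left.1 hPQ hv
  rcases hLe with hLe | hLe <;> rcases hRe with hRe | hRe
  · exact (mem_union.1 (hP hs)).elim (fun h => hemp hLe h hs) (fun h => hemp hRe h hs)
  · have h1 := hα.resolve_left (hemp hLe hαL)
    have h2 := hβ.resolve_right (hemp hRe hβR)
    exact hadj _ h2 _ h1 (hK i fun he => hdisj _ h2 (he ▸ h1)).symm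
  · have h1 := hα.resolve_right (hemp hLe hαL)
    have h2 := hβ.resolve_left (hemp hRe hβR)
    exact hadj _ h1 _ h2 (hK i fun he => hdisj _ h1 (he ▸ h2))
  · exact (mem_union.1 (hQ ht)).elim (fun h => hemp hLe h ht) (fun h => hemp hRe h ht)

/-! ### Side graphs inherit super-minimality -/

/-- A linking in which every common vertex has at least two neighbours on either side. -/
structure WellLinkedBy (G : SimpleGraph V) (L R : Finset V) (α β : Fin 3 → V) : Prop
    extends G.LinkedBy L R α β where
  two_le_left : ∀ i, α i = β i → 2 ≤ #(G.nbrs (L \ R) (α i))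
  two_le_right : ∀ i, α i = β i → 2 ≤ #(G.nbrs (R \ L) (β i))

lemma WellLinkedBy.symm (h : G.WellLinkedBy L R α β) : G.WellLinkedBy R L β α where
  toLinkedBy := h.toLinkedBy.symm
  two_le_left i hi := h.two_le_right i hi.symm
  two_le_right i hi := h.two_le_left i hi.symm

lemma WellLinkedBy.triconnectedOn_left (h : G.WellLinkedBy L R α β)
    (hG : G.TriconnectedOn (L ∪ R)) :
    (G.sideGraph L R α (β 0)).TriconnectedOn (insert (β 0) L) :=
  h.triconnectedOn_sideGraph hG h.two_le_left h.zero_notMem_left (h.mem_right 0)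

lemma WellLinkedBy.triconnectedOn_right (h : G.WellLinkedBy L R α β)
    (hG : G.TriconnectedOn (L ∪ R)) :
    (G.sideGraph R L β (α 0)).TriconnectedOn (insert (α 0) R) :=
  h.symm.triconnectedOn_left (by rwa [union_comm])

/-- Side graphs omit the edges within `L ∩ R`, so gluing them shows that these edges are not needed
for 3-connectivity. -/
lemma WellLinkedBy.not_adj_of_mem_inter (h : G.WellLinkedBy L R α β)
    (hG : G.SuperminimalOn (L ∪ R)) (hu : u ∈ L ∩ R) (hw : w ∈ L ∩ R) : ¬ G.Adj u w := by
  intro huw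
  let K : SimpleGraph V :=
    { Adj := fun u w => G.Adj u w ∧ ¬ (u ∈ L ∩ R ∧ w ∈ L ∩ R)
      symm := ⟨fun u w h => ⟨h.1.symm, fun h' => h.2 h'.symm⟩⟩
      loopless := ⟨fun u h => G.irrefl h.1⟩ }
  have hK : K.TriconnectedOn (L ∪ R) := by
    refine h.triconnectedOn_glue (h.triconnectedOn_left hG.1) h.zero_notMem_left
      (fun w _ hw => (sideGraph_adj_fresh h.mem_left h.zero_notMem_left).1 hw) ?_
      (h.triconnectedOn_right hG.1) h.zero_notMem_right
      (fun w _ hw => (sideGraph_adj_fresh h.mem_right h.zero_notMem_right).1 hw) ?_ ?_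
    · intro u hu w hw huw
      rw [sideGraph_adj_of_mem h.zero_notMem_left hu hw] at huw
      refine ⟨huw.1, fun h => huw.2 ⟨(mem_inter.1 h.1).2, (mem_inter.1 h.2).2⟩⟩
    · intro u hu w hw huw
      rw [sideGraph_adj_of_mem h.zero_notMem_right hu hw] at huw
      refine ⟨huw.1, fun h => huw.2 ⟨(mem_inter.1 h.1).1, (mem_inter.1 h.2).1⟩⟩
    · intro i hi
      exact ⟨h.adj i hi, fun h' => hi (h.eq_of_left_mem i (mem_inter.1 h'.1).2)⟩
  have := (hG.2 (L ∪ R) Subset.rfl K (fun u w h => h.1) hK).2 u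
    (mem_union_left _ (mem_inter.1 hu).1) w (mem_union_left _ (mem_inter.1 hw).1) huw
  exact this.2 ⟨hu, hw⟩

lemma WellLinkedBy.superminimalOn_left (h : G.WellLinkedBy L R α β)
    (hG : G.SuperminimalOn (L ∪ R)) :
    (G.sideGraph L R α (β 0)).SuperminimalOn (insert (β 0) L) := by
  refine ⟨h.triconnectedOn_left hG.1, fun W' hW' H hH hHW => ?_⟩
  have hy := h.zero_notMem_left
  have hWL : ∀ v ∈ W', v ≠ β 0 → v ∈ L := fun v hv hne => (mem_insert.1 (hW' hv)).resolve_left hne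
  have hHG : ∀ u ∈ L, ∀ w ∈ L, H.Adj u w → G.Adj u w := fun u hu w hw huw =>
    ((sideGraph_adj_of_mem hy hu hw).1 (hH huw)).1
  -- Without the added vertex, `H` restricts to a 3-connected subgraph of `G` that misses `β 0`.
  by_cases hyW : β 0 ∈ W'
  swap
  · have hWL' : W' ⊆ L := fun v hv => hWL v hv (by rintro rfl; exact hyW hv)
    have := (hG.2 W' (hWL'.trans subset_union_left) (H ⊓ G) inf_le_right (hHW.mono
      fun u hu w hw huw => ⟨huw, hHG u (hWL' hu) w (hWL' hw) huw⟩)).1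
    exact absurd (this ▸ mem_union_right _ (h.mem_right 0)) hyW
  have hHy : ∀ w, H.Adj (β 0) w → ∃ i, w = α i := fun w hw =>
    (sideGraph_adj_fresh h.mem_left hy).1 (hH hw)
  -- The added vertex has only three possible neighbours and needs all of them.
  have hα : ∀ i, α i ∈ W' ∧ H.Adj (β 0) (α i) := by
    have hsub : H.nbrs W' (β 0) ⊆ univ.image α := fun w hw => by
      obtain ⟨i, rfl⟩ := hHy w (mem_nbrs.1 hw).2
      exact mem_image_of_mem _ (mem_univ i)
    have heq := eq_of_subset_of_card_le hsub (by
      rw [card_image_of_injective _ h.inj_left, card_univ, Fintype.card_fin]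
      exact hHW.three_le_card_nbrs hyW)
    intro i
    exact mem_nbrs.1 (heq ▸ mem_image_of_mem α (mem_univ i))
  have hαne : ∀ i, α i ≠ β 0 := fun i he => hy (he ▸ h.mem_left i)
  -- `K` is `G` with its edges inside `L` cut down to those of `H`.
  let K : SimpleGraph V :=
    { Adj := fun u w => G.Adj u w ∧ (u ∈ L → w ∈ L → H.Adj u w)
      symm := ⟨fun u w h => ⟨h.1.symm, fun hw hu => (h.2 hu hw).symm⟩⟩
      loopless := ⟨fun u h => G.irrefl h.1⟩ }
  have hL' : W'.erase (β 0) ⊆ L := fun v hv => hWL v (mem_of_mem_erase hv) (ne_of_mem_erase hv)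
  have hP : Ported (W'.erase (β 0)) R α β :=
    { h.toPorted with
      mem_left := fun i => mem_erase.2 ⟨hαne i, (hα i).1⟩
      eq_of_right_mem := fun i hi => h.eq_of_right_mem i (hL' hi)
      exists_of_mem := fun v hv => h.exists_of_mem v (hL' hv) }
  have hK : K.TriconnectedOn (W'.erase (β 0) ∪ R) := by
    refine hP.triconnectedOn_glue (A := H) (y := β 0) (by rwa [insert_erase hyW])
      (notMem_erase _ _) (fun w _ hw => hHy w hw) ?_
      (h.triconnectedOn_right hG.1) h.zero_notMem_right
      (fun w _ hw => (sideGraph_adj_fresh h.mem_right h.zero_notMem_right).1 hw) ?_ ?_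
    · intro u hu w hw huw
      exact ⟨hHG u (hL' hu) w (hL' hw) huw, fun _ _ => huw⟩
    · intro u hu w hw huw
      rw [sideGraph_adj_of_mem h.zero_notMem_right hu hw] at huw
      exact ⟨huw.1, fun h1 h2 => absurd ⟨h1, h2⟩ huw.2⟩
    · intro i hi
      exact ⟨h.adj i hi, fun _ hβ => absurd (h.eq_of_right_mem i hβ) hi⟩
  obtain ⟨hW, hadj⟩ := hG.2 _ (union_subset_union hL' Subset.rfl) K (fun u w h => h.1) hK
  have hLW : ∀ v ∈ L, v ∈ W' := by
    intro v hv
    by_cases hvR : v ∈ R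
    · obtain ⟨i, rfl, -⟩ := h.exists_of_mem v hv hvR
      exact (hα i).1
    · have : v ∈ W'.erase (β 0) ∪ R := hW ▸ mem_union_left _ hv
      exact mem_of_mem_erase ((mem_union.1 this).resolve_right hvR)
  refine ⟨hW'.antisymm (insert_subset hyW hLW), ?_⟩
  intro u hu w hw huw
  rcases mem_insert.1 hu with rfl | hu
  · obtain ⟨i, rfl⟩ := (sideGraph_adj_fresh h.mem_left hy).1 huw
    exact (hα i).2
  rcases mem_insert.1 hw with rfl | hw
  · obtain ⟨i, rfl⟩ := (sideGraph_adj_fresh h.mem_left hy).1 huw.symm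
    exact (hα i).2.symm
  · rw [sideGraph_adj_of_mem hy hu hw] at huw
    exact (hadj u (mem_union_left _ hu) w (mem_union_left _ hw) huw.1).2 hu hw

/-! ### Degree sums of the side graphs -/

lemma Ported.card_inter_add (h : Ported L R α β) :
    #(L ∩ R) + #{i | α i ≠ β i} = 3 := by
  have : L ∩ R = (univ.filter fun i => α i = β i).image α := by
    ext v
    simp only [mem_inter, mem_image, mem_filter, mem_univ, true_and]
    constructor
    · rintro ⟨hL, hR⟩
      obtain ⟨i, hi, hi'⟩ := h.exists_of_mem v hL hR
      exact ⟨i, hi.trans hi'.symm, hi⟩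
    · rintro ⟨i, hi, rfl⟩
      exact ⟨h.mem_left i, hi ▸ h.mem_right i⟩
  rw [this, card_image_of_injective _ h.inj_left]
  exact card_filter_add_card_filter_not _

lemma LinkedBy.sum_card_nbrs (h : G.LinkedBy L R α β) :
    ∑ u ∈ L \ R, #(G.nbrs (R \ L) u) = #{i | α i ≠ β i} := by
  rw [← card_sigma]
  refine (card_bij (fun i _ => (⟨α i, β i⟩ : Σ _ : V, V)) ?_ ?_ ?_).symm
  · intro i hi
    have hi := (mem_filter.1 hi).2
    simp only [mem_sigma, mem_sdiff, mem_nbrs]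
    exact ⟨⟨h.mem_left i, fun hm => hi (h.eq_of_left_mem i hm)⟩,
      ⟨h.mem_right i, fun hm => hi (h.eq_of_right_mem i hm)⟩, h.adj i hi⟩
  · intro i _ j _ hij
    exact h.inj_left (Sigma.mk.inj_iff.1 hij).1
  · rintro ⟨u, w⟩ huw
    simp only [mem_sigma, mem_sdiff, mem_nbrs] at huw
    obtain ⟨i, rfl, rfl⟩ := h.exists_of_adj u huw.1.1 huw.1.2 w huw.2.1.1 huw.2.1.2 huw.2.2
    refine ⟨i, mem_filter.2 ⟨mem_univ i, fun he => huw.1.2 ?_⟩, rfl⟩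
    exact he ▸ h.mem_right i

lemma Ported.degreeSumOn_sideGraph (h : Ported L R α β)
    (hind : ∀ u ∈ L ∩ R, ∀ w ∈ L ∩ R, ¬ G.Adj u w) :
    (G.sideGraph L R α (β 0)).degreeSumOn (insert (β 0) L) = G.degreeSumOn L + 6 := by
  have hy := h.zero_notMem_left
  rw [insert_eq, degreeSumOn_union (by simpa using hy), sum_singleton]
  have h0 : (G.sideGraph L R α (β 0)).degreeSumOn {β 0} = 0 := by
    simp [degreeSumOn, nbrs, filter_singleton]
  have h3 : (G.sideGraph L R α (β 0)).nbrs L (β 0) = univ.image α := by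
    ext v
    simp only [mem_nbrs, sideGraph_adj_fresh h.mem_left hy, mem_image, mem_univ, true_and]
    constructor
    · rintro ⟨-, i, rfl⟩
      exact ⟨i, rfl⟩
    · rintro ⟨i, rfl⟩
      exact ⟨h.mem_left i, i, rfl⟩
  have hL : (G.sideGraph L R α (β 0)).degreeSumOn L = G.degreeSumOn L := by
    refine sum_congr rfl fun u hu => congrArg card ?_
    ext w
    simp only [mem_nbrs]
    refine and_congr_right fun hw => ?_
    rw [sideGraph_adj_of_mem hy hu hw]
    refine ⟨And.left, fun huw => ⟨huw, fun hR => ?_⟩⟩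
    exact hind u (mem_inter.2 ⟨hu, hR.1⟩) w (mem_inter.2 ⟨hw, hR.2⟩) huw
  rw [h0, h3, hL, card_image_of_injective _ h.inj_left, card_univ, Fintype.card_fin]
  omega

/-- Each added vertex contributes 6 to its side graph, while `G` has `3 - #(L ∩ R)` edges across.
Nothing is counted twice because `L ∩ R` is independent. -/
lemma LinkedBy.degreeSumOn_add (h : G.LinkedBy L R α β)
    (hind : ∀ u ∈ L ∩ R, ∀ w ∈ L ∩ R, ¬ G.Adj u w) :
    G.degreeSumOn (L ∪ R) + 6 + 2 * #(L ∩ R) =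
      (G.sideGraph L R α (β 0)).degreeSumOn (insert (β 0) L) +
      (G.sideGraph R L β (α 0)).degreeSumOn (insert (α 0) R) := by
  rw [h.degreeSumOn_sideGraph hind, h.symm.degreeSumOn_sideGraph (by rwa [inter_comm R])]
  have h1 : G.degreeSumOn (L ∪ R) = G.degreeSumOn L + G.degreeSumOn (R \ L) +
      2 * ∑ u ∈ L, #(G.nbrs (R \ L) u) := by
    rw [← degreeSumOn_union disjoint_sdiff, union_sdiff_self_eq_union]
  have h2 : G.degreeSumOn R = G.degreeSumOn (L ∩ R) + G.degreeSumOn (R \ L) +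
      2 * ∑ u ∈ L ∩ R, #(G.nbrs (R \ L) u) := by
    rw [← degreeSumOn_union (disjoint_sdiff.mono_left inter_subset_left)]
    congr 1
    ext v
    simp only [mem_union, mem_inter, mem_sdiff]
    tauto
  have h3 : G.degreeSumOn (L ∩ R) = 0 := by
    refine sum_eq_zero fun u hu => card_eq_zero.2 (eq_empty_iff_forall_notMem.2 fun w hw => ?_)
    exact hind u hu w (mem_nbrs.1 hw).1 (mem_nbrs.1 hw).2
  have h4 : ∑ u ∈ L, #(G.nbrs (R \ L) u) =
      ∑ u ∈ L ∩ R, #(G.nbrs (R \ L) u) + ∑ u ∈ L \ R, #(G.nbrs (R \ L) u) := by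
    rw [← sum_union (disjoint_sdiff_inter L R).symm]
    congr 1
    rw [union_comm, sdiff_union_inter]
  have h5 := h.sum_card_nbrs
  have h6 := h.card_inter_add
  omega

/-! ### Separations at an edge, and excluding hubs -/

lemma SuperminimalOn.exists_separation (hG : G.SuperminimalOn W) (hx : x ∈ W) (hy : y ∈ W)
    (hxy : G.Adj x y) : ∃ P ⊆ W, ∃ Q ⊆ W, x ∈ P ∧ y ∈ Q ∧ Disjoint P Q ∧
      (∀ u ∈ P, ∀ w ∈ Q, G.Adj u w → u = x ∧ w = y) ∧ #(W \ (P ∪ Q)) ≤ 2 := by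
  have hno : ¬ (G.deleteEdges {s(x, y)}).TriconnectedOn W := by
    intro h
    have := (hG.2 W Subset.rfl _ (G.deleteEdges_le _) h).2 x hx y hy hxy
    simp [deleteEdges_adj] at this
  obtain ⟨P, hP, Q, hQ, hP', hQ', hPQ, hadj, hX⟩ := not_triconnectedOn hno hG.1.1
  have hadj' : ∀ u ∈ P, ∀ w ∈ Q, G.Adj u w → u = x ∧ w = y ∨ u = y ∧ w = x := by
    intro u hu w hw huw
    have := hadj u hu w hw
    simp only [deleteEdges_adj, huw, true_and, not_not, Set.mem_singleton_iff, Sym2.eq_iff] at this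
    exact this
  by_cases h1 : x ∈ P ∧ y ∈ Q
  · refine ⟨P, hP, Q, hQ, h1.1, h1.2, hPQ, fun u hu w hw huw => ?_, hX⟩
    refine (hadj' u hu w hw huw).resolve_right ?_
    rintro ⟨rfl, rfl⟩
    exact Finset.disjoint_left.1 hPQ hu h1.2
  by_cases h2 : y ∈ P ∧ x ∈ Q
  · refine ⟨Q, hQ, P, hP, h2.2, h2.1, hPQ.symm, fun u hu w hw huw => ?_, by rwa [union_comm]⟩
    refine ((hadj' w hw u hu huw.symm).resolve_left ?_).symm
    rintro ⟨rfl, rfl⟩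
    exact Finset.disjoint_left.1 hPQ hw h2.2
  refine (hG.1.not_separated hP hQ hP' hQ' hPQ (X := W \ (P ∪ Q)) ?_ ?_ hX).elim
  · intro u hu w hw huw
    rcases hadj' u hu w hw huw with ⟨rfl, rfl⟩ | ⟨rfl, rfl⟩
    · exact h1 ⟨hu, hw⟩
    · exact h2 ⟨hu, hw⟩
  · intro v hv
    simp only [mem_union, mem_sdiff] at *
    tauto

lemma exists_index_of_ne_zero {i : Fin 3} (hi : i ≠ 0) :
    ∃ k : Fin 3, k ≠ 0 ∧ k ≠ i ∧ ∀ m, m = 0 ∨ m = i ∨ m = k := by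
  revert i
  decide

/-- If the side graph is a wheel whose hub is an end of the port `0`, then the edge from the hub to
a common vertex of both sides can be deleted. -/
lemma WellLinkedBy.not_hubbedOn (h : G.WellLinkedBy L R α β) (hG : G.SuperminimalOn (L ∪ R))
    (hx : 4 ≤ #(G.nbrs (L ∪ R) (α 0))) (hne : (L ∩ R).Nonempty) :
    ¬ (G.sideGraph L R α (β 0)).HubbedOn (insert (β 0) L) := by
  rintro ⟨x, hxL, hhub⟩
  set S := G.sideGraph L R α (β 0) with hS
  have hyL := h.zero_notMem_left
  have hxR := h.zero_notMem_right
  have hα0 := h.mem_left 0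
  have hSK := h.triconnectedOn_left hG.1
  rw [← hS] at hSK
  have hSy : ∀ i, S.Adj (β 0) (α i) := fun i => (sideGraph_adj_fresh h.mem_left hyL).2 ⟨i, rfl⟩
  have hGx : G.nbrs (L ∪ R) (α 0) ⊆ S.nbrs (insert (β 0) L) (α 0) := by
    intro w hw
    rw [mem_nbrs] at hw ⊢
    by_cases hwL : w ∈ L
    · exact ⟨mem_insert_of_mem hwL, (sideGraph_adj_of_mem hyL hα0 hwL).2
        ⟨hw.2, fun h => hxR h.1⟩⟩
    · obtain ⟨i, hi, rfl⟩ := h.exists_of_adj _ hα0 hxR w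
        ((mem_union.1 hw.1).resolve_left hwL) hwL hw.2
      obtain rfl := h.inj_left hi
      exact ⟨mem_insert_self _ _, (hSy 0).symm⟩
  have hx4 := hx.trans (card_le_card hGx)
  -- Only the hub can have degree above 3.
  obtain rfl : x = α 0 := by
    by_contra hne
    have := (hhub (α 0) (mem_insert_of_mem hα0) fun he => hne he.symm).2
    omega
  obtain ⟨b, hb⟩ := hne
  obtain ⟨i, rfl, hβi⟩ := h.exists_of_mem b (mem_inter.1 hb).1 (mem_inter.1 hb).2
  have hi0 : i ≠ 0 := by
    rintro rfl
    exact h.ne_zero hβi.symm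
  obtain ⟨k, hk0, hki, hk⟩ := exists_index_of_ne_zero hi0
  have hbL := h.mem_left i
  have hxb : α i ≠ α 0 := fun he => hi0 (h.inj_left he)
  have hαy : ∀ j, α j ≠ β 0 := fun j he => hyL (he ▸ h.mem_left j)
  have hhub' : ∀ u ∈ L, u ≠ α 0 → G.Adj (α 0) u := fun u hu hne =>
    ((sideGraph_adj_of_mem hyL hα0 hu).1 (hhub u (mem_insert_of_mem hu) hne).1).1
  -- the further neighbour of the common vertex on the rim
  obtain ⟨c, hc, hcne⟩ : ∃ c ∈ S.nbrs (insert (β 0) L) (α i), c ∉ ({α 0, β 0} : Finset V) := by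
    by_contra! hcon
    have := (card_le_card hcon).trans card_le_two
    have := (hhub (α i) (mem_insert_of_mem hbL) hxb).2
    omega
  simp only [mem_insert, mem_singleton, not_or] at hcne
  rw [mem_nbrs] at hc
  have hcL : c ∈ L := (mem_insert.1 hc.1).resolve_left hcne.2
  have hbc := (sideGraph_adj_of_mem hyL hbL hcL).1 hc.2
  have hbR : α i ∈ R := (mem_inter.1 hb).2
  have hcR : c ∉ R := fun hcR => hbc.2 ⟨hbR, hcR⟩
  -- Otherwise `β 0`, `α i`, `α k` would close up a rim of their own, and the hub alone would
  -- separate them from its fourth neighbour.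
  have hck : c ≠ α k := by
    rintro rfl
    have hnb : ∀ {u p q r : V}, u ∈ insert (β 0) L → u ≠ α 0 → S.Adj u p → S.Adj u q →
        S.Adj u r → p ≠ q → p ≠ r → q ≠ r → p ∈ insert (β 0) L → q ∈ insert (β 0) L →
        r ∈ insert (β 0) L → ∀ w ∈ insert (β 0) L, S.Adj u w → w = p ∨ w = q ∨ w = r := by
      intro u p q r hu hne hp hq hr hpq hpr hqr hp' hq' hr' w hw huw
      have hsub : ({p, q, r} : Finset V) ⊆ S.nbrs (insert (β 0) L) u := by
        intro v hv
        simp only [mem_insert, mem_singleton] at hv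
        rw [mem_nbrs]
        rcases hv with rfl | rfl | rfl
        exacts [⟨hp', hp⟩, ⟨hq', hq⟩, ⟨hr', hr⟩]
      have heq := eq_of_subset_of_card_le hsub (by
        rw [(hhub u hu hne).2, card_eq_three.2 ⟨p, q, r, hpq, hpr, hqr, rfl⟩])
      have : w ∈ ({p, q, r} : Finset V) := heq ▸ mem_nbrs.2 ⟨hw, huw⟩
      simpa using this
    have hkL := h.mem_left k
    have hmem : ∀ j, α j ∈ insert (β 0) L := fun j => mem_insert_of_mem (h.mem_left j)
    have hik : α i ≠ α k := fun he => hki (h.inj_left he).symm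
    have hx' : ∀ j, j ≠ 0 → S.Adj (α j) (α 0) := fun j hj =>
      (hhub _ (hmem j) fun he => hj (h.inj_left he)).1.symm
    obtain ⟨q, hq, hqne⟩ : ∃ q ∈ S.nbrs (insert (β 0) L) (α 0),
        q ∉ ({β 0, α i, α k} : Finset V) := by
      by_contra! hcon
      have := (card_le_card hcon).trans card_le_three
      omega
    rw [mem_nbrs] at hq
    refine hSK.not_separated (P := {β 0, α i, α k})
      (Q := insert (β 0) L \ {α 0, β 0, α i, α k}) (X := {α 0}) ?_ sdiff_subset
      (insert_nonempty _ _) ⟨q, ?_⟩ ?_ ?_ ?_ (by simp)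
    · intro v hv
      simp only [mem_insert, mem_singleton] at hv
      rcases hv with rfl | rfl | rfl
      exacts [mem_insert_self _ _, hmem i, hmem k]
    · rw [mem_sdiff]
      refine ⟨hq.1, fun hq' => ?_⟩
      rw [mem_insert] at hq'
      rcases hq' with rfl | hq'
      · exact S.irrefl hq.2
      · exact hqne hq'
    · rw [Finset.disjoint_right]
      intro v hv hv'
      exact (mem_sdiff.1 hv).2 (mem_insert_of_mem hv')
    · intro u hu w hw huw
      rw [mem_sdiff] at hw
      refine hw.2 ?_
      simp only [mem_insert, mem_singleton] at hu ⊢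
      rcases hu with rfl | rfl | rfl
      · obtain ⟨m, rfl⟩ := (sideGraph_adj_fresh h.mem_left hyL).1 huw
        rcases hk m with rfl | rfl | rfl <;> simp
      · rcases hnb (hmem i) hxb (hx' i hi0) (hSy i).symm hc.2 (hαy 0)
          (Ne.symm hcne.1) (hαy k).symm (hmem 0) (mem_insert_self _ _) (hmem k) w hw.1 huw
          with rfl | rfl | rfl <;> simp
      · rcases hnb (hmem k) hcne.1 (hx' k hk0) (hSy k).symm hc.2.symm (hαy 0)
          hxb.symm (hαy i).symm (hmem 0) (mem_insert_self _ _) (hmem i) w hw.1 huw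
          with rfl | rfl | rfl <;> simp
    · intro v hv
      simp only [mem_union, mem_sdiff, mem_insert, mem_singleton] at *
      tauto
  have hxbG := hhub' _ hbL hxb
  obtain ⟨P, hP, Q, hQ, hxP, hbQ, hPQ, hadj, hX⟩ := hG.exists_separation
    (mem_union_left _ hα0) (mem_union_left _ hbL) hxbG
  have hPnQ : ∀ v ∈ P, v ∉ Q := fun v hv => Finset.disjoint_left.1 hPQ hv
  have hxQ : ∀ v, v ≠ α i → G.Adj (α 0) v → v ∉ Q := fun v hne hv hvQ =>
    hne (hadj _ hxP v hvQ hv).2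
  -- `c` is adjacent to both ends of the deleted edge, so it uses up one removed vertex, and this
  -- one is outside `R`.
  have hcPQ : c ∉ P ∪ Q := by
    rw [mem_union, not_or]
    refine ⟨fun hcP => hcne.1 (hadj c hcP _ hbQ hbc.1.symm).1, ?_⟩
    exact hxQ c hbc.1.ne' (hhub' c hcL hcne.1)
  have hcX : c ∈ (L ∪ R) \ (P ∪ Q) := mem_sdiff.2 ⟨mem_union_left _ hcL, hcPQ⟩
  have hX1 : #(((L ∪ R) \ (P ∪ Q)).erase c) ≤ 1 := by
    rw [card_erase_of_mem hcX]
    omega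
  have hRX : R \ (P ∪ Q) ⊆ ((L ∪ R) \ (P ∪ Q)).erase c := by
    intro v hv
    rw [mem_sdiff] at hv
    refine mem_erase.2 ⟨?_, mem_sdiff.2 ⟨mem_union_right _ hv.1, hv.2⟩⟩
    rintro rfl
    exact hcR hv.1
  have hyQ : β 0 ∉ Q := hxQ _ (hαy i).symm (h.adj 0 h.ne_zero)
  have hkQ : α k ∉ Q := hxQ _ (fun he => hki (h.inj_left he))
    (hhub' _ (h.mem_left k) fun he => hk0 (h.inj_left he))
  have hxR' : ∀ u ∈ R, u ≠ α 0 := by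
    rintro u hu rfl
    exact hxR hu
  have hB := h.triconnectedOn_right hG.1
  have hBadj : ∀ u ∈ P, ∀ w ∈ Q, u ∈ R → w ∈ R →
      ¬ (G.sideGraph R L β (α 0)).Adj u w := by
    intro u hu w hw huR hwR huw
    rw [sideGraph_adj_of_mem hxR huR hwR] at huw
    exact hxR' u huR (hadj u hu w hw huw.1).1
  -- If `β k ∈ Q`, then `α k` is the second removed vertex, so `R` loses nothing although it meets
  -- both `P` and `Q`. Otherwise `α i` and the vertex of `R` possibly removed cut off the rest of `Q
  -- ∩ R` in the right side graph; this rest is nonempty since `α i` has two neighbours in `R \ L`.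
  by_cases hβk : β k ∈ Q
  · have hne : α k ≠ β k := fun he => hkQ (he ▸ hβk)
    have hkP : α k ∉ P := fun hkP =>
      hk0 (h.inj_left (hadj _ hkP _ hβk (h.adj k hne)).1)
    have hRe : R \ (P ∪ Q) = ∅ := by
      rw [eq_empty_iff_forall_notMem]
      intro v hv
      have h1 := hRX hv
      have h2 : α k ∈ ((L ∪ R) \ (P ∪ Q)).erase c := by
        simp [hck.symm, h.mem_left k, hkP, hkQ]
      obtain rfl := card_le_one.1 hX1 _ h1 _ h2
      exact hne (h.eq_of_left_mem k (mem_sdiff.1 hv).1)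
    rcases hB.inter_eq_empty hPQ hBadj (by simp [hRe]) with he | he
    · have hyP : β 0 ∈ P := by
        by_contra hyP
        refine notMem_empty (β 0) (hRe ▸ ?_)
        simp [h.mem_right 0, hyP, hyQ]
      exact notMem_empty (β 0) (he ▸ mem_inter.2 ⟨hyP, h.mem_right 0⟩)
    · exact notMem_empty (α i) (he ▸ mem_inter.2 ⟨hbQ, hbR⟩)
  · have hR1 : #(R \ (P ∪ Q)) ≤ 1 := (card_le_card hRX).trans hX1
    obtain ⟨q, hq, hqX⟩ : ∃ q ∈ G.nbrs (R \ L) (β i), q ∉ R \ (P ∪ Q) := by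
      by_contra! hcon
      have := card_le_card hcon
      have := h.two_le_right i hβi.symm
      omega
    rw [mem_nbrs, mem_sdiff, hβi] at hq
    have hqQ : q ∈ Q := by
      by_contra hqQ
      have hqP : q ∉ P := fun hqP => hxR' q hq.1.1 (hadj q hqP _ hbQ hq.2.symm).1
      exact hqX (by simp [hq.1.1, hqP, hqQ])
    refine hB.not_separated (P := insert (α 0) (P ∩ R)) (Q := (Q ∩ R).erase (α i))
      (X := insert (α i) (R \ (P ∪ Q))) (insert_subset_insert _ inter_subset_right)
      ((erase_subset _ _).trans (inter_subset_right.trans (subset_insert _ _)))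
      (insert_nonempty _ _) ⟨q, mem_erase.2 ⟨hq.2.ne', mem_inter.2 ⟨hqQ, hq.1.1⟩⟩⟩ ?_ ?_ ?_
      ((card_insert_le _ _).trans (by omega))
    · rw [Finset.disjoint_right]
      intro v hv
      simp only [mem_erase, mem_inter] at hv
      rw [mem_insert, not_or, mem_inter]
      exact ⟨hxR' v hv.2.2, fun h => hPnQ v h.1 hv.2.1⟩
    · intro u hu w hw huw
      rw [mem_erase, mem_inter] at hw
      rcases mem_insert.1 hu with rfl | hu
      · obtain ⟨m, rfl⟩ := (sideGraph_adj_fresh h.mem_right hxR).1 huw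
        rcases hk m with rfl | rfl | rfl
        · exact hyQ hw.2.1
        · exact hw.1 hβi
        · exact hβk hw.2.1
      · rw [mem_inter] at hu
        exact hBadj u hu.1 w hw.2.1 hu.2 hw.2.2 huw
    · intro v hv
      rcases mem_insert.1 hv with rfl | hv
      · simp
      by_cases hvP : v ∈ P
      · simp [hvP, hv]
      by_cases hvQ : v ∈ Q
      · by_cases hvb : v = α i <;> simp [hvQ, hv, hvb]
      · simp [hvP, hvQ, hv]

/-! ### Making a linking well linked -/

/-- This keeps the ports distinct when port `i` is moved to `a`. If there were no such `a`, then `β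
0` and `β k` would separate the rest of `R \ L` from `α 0`; if there is no rest, `β 0` has at most
three neighbours. -/
lemma LinkedBy.exists_nbr_notMem (h : G.LinkedBy L R α β) (hG : G.TriconnectedOn (L ∪ R))
    (hdeg : 4 ≤ #(G.nbrs (L ∪ R) (β 0))) (hcard : 2 ≤ #(R \ L)) {i k : Fin 3} (hαβ : α i = β i)
    (hk : ∀ m, m = 0 ∨ m = i ∨ m = k) (hki : k ≠ i) (hi0 : i ≠ 0) :
    ∃ a ∈ G.nbrs (R \ L) (β i), a ∉ ({β 0, β k} : Finset V) := by
  by_contra! hcon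
  have hmem : ∀ u ∈ R \ L, G.Adj (β i) u → u = β 0 ∨ u = β k := fun u hu hiu => by
    simpa using hcon u (mem_nbrs.2 ⟨hu, hiu⟩)
  have hβiL : β i ∈ L := hαβ ▸ h.mem_left i
  have hPadj : ∀ u ∈ R \ L, u ∉ ({β 0, β k} : Finset V) → ∀ w ∈ L, w ∉ ({β 0, β k} : Finset V) →
      ¬ G.Adj u w := by
    intro u hu huD w hw hwD huw
    simp only [mem_insert, mem_singleton, not_or] at huD hwD
    by_cases hwR : w ∈ R
    · obtain ⟨m, -, rfl⟩ := h.exists_of_mem w hw hwR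
      rcases hk m with rfl | rfl | rfl
      · exact hwD.1 rfl
      · have := hmem u hu huw.symm
        tauto
      · exact hwD.2 rfl
    · rw [mem_sdiff] at hu
      obtain ⟨m, -, rfl⟩ := h.exists_of_adj w hw hwR u hu.1 hu.2 huw.symm
      rcases hk m with rfl | rfl | rfl
      · exact huD.1 rfl
      · exact hu.2 hβiL
      · exact huD.2 rfl
  by_cases hP : ((R \ L) \ {β 0, β k}).Nonempty
  · refine hG.not_separated (P := (R \ L) \ {β 0, β k})
      (Q := (L ∪ R) \ ((R \ L) ∪ {β 0, β k})) (X := {β 0, β k})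
      (sdiff_subset.trans (sdiff_subset.trans subset_union_right)) sdiff_subset hP
      ⟨α 0, ?_⟩ ?_ ?_ ?_ card_le_two
    · have h1 := h.mem_left 0
      have h2 := h.zero_notMem_right
      have h3 : α 0 ≠ β k := fun he => h2 (he ▸ h.mem_right k)
      simp [h1, h2, h3, h.ne_zero]
    · rw [Finset.disjoint_right]
      intro v hv
      simp only [mem_sdiff, mem_union] at hv ⊢
      tauto
    · intro u hu w hw
      rw [mem_sdiff, mem_union, mem_union, mem_sdiff] at hw
      rw [mem_sdiff] at hu
      exact hPadj u hu.1 hu.2 w (by tauto) (by tauto)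
    · intro v hv
      simp only [mem_sdiff, mem_union] at hv ⊢
      tauto
  · rw [not_nonempty_iff_eq_empty, sdiff_eq_empty_iff_subset] at hP
    have hBeq := eq_of_subset_of_card_le hP (card_le_two.trans hcard)
    have hsub : G.nbrs (L ∪ R) (β 0) ⊆ {α 0, β i, β k} := by
      intro w hw
      rw [mem_nbrs, mem_union] at hw
      simp only [mem_insert, mem_singleton]
      by_cases hwL : w ∈ L
      · by_cases hwR : w ∈ R
        · obtain ⟨m, -, rfl⟩ := h.exists_of_mem w hwL hwR
          rcases hk m with rfl | rfl | rfl
          · exact absurd rfl hw.2.ne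
          · simp
          · simp
        · obtain ⟨m, rfl, hm⟩ := h.exists_of_adj w hwL hwR _ (h.mem_right 0)
            h.zero_notMem_left hw.2.symm
          rw [← h.inj_right hm]
          simp
      · have : w ∈ ({β 0, β k} : Finset V) :=
          hBeq ▸ mem_sdiff.2 ⟨hw.1.resolve_left hwL, hwL⟩
        rw [mem_insert, mem_singleton] at this
        rcases this with rfl | rfl
        · exact absurd rfl hw.2.ne
        · simp
    have := (card_le_card hsub).trans card_le_three
    omega

/-- A common vertex with at most one neighbour in `R \ L` can be removed from `R`. -/
lemma LinkedBy.exists_erase (h : G.LinkedBy L R α β) (hG : G.TriconnectedOn (L ∪ R))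
    (hdeg : 4 ≤ #(G.nbrs (L ∪ R) (β 0))) (hcard : 2 ≤ #(R \ L)) {i : Fin 3} (hαβ : α i = β i)
    (hi : #(G.nbrs (R \ L) (β i)) ≤ 1) :
    ∃ β' : Fin 3 → V, β' 0 = β 0 ∧ G.LinkedBy L (R.erase (α i)) α β' := by
  have hi0 : i ≠ 0 := by
    rintro rfl
    exact h.ne_zero hαβ
  obtain ⟨k, -, hki, hk⟩ := exists_index_of_ne_zero hi0
  obtain ⟨a, ha, hak⟩ := h.exists_nbr_notMem hG hdeg hcard hαβ hk hki hi0
  simp only [mem_insert, mem_singleton, not_or] at hak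
  have huniq : ∀ w ∈ R, w ∉ L → G.Adj (β i) w → w = a := fun w hw hwL hiw =>
    card_le_one.1 hi w (mem_nbrs.2 ⟨mem_sdiff.2 ⟨hw, hwL⟩, hiw⟩) a ha
  rw [mem_nbrs, mem_sdiff] at ha
  have haβ : ∀ m, a ≠ β m := by
    intro m
    rcases hk m with rfl | rfl | rfl
    exacts [hak.1, fun he => ha.1.2 (he ▸ hαβ ▸ h.mem_left m), hak.2]
  have hne : ∀ m, m ≠ i → Function.update β i a m = β m := fun m hm =>
    Function.update_of_ne hm _ _
  have heq : Function.update β i a i = a := Function.update_self _ _ _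
  -- Port `i` becomes the edge from `α i` to its only neighbour in `R \ L`.
  refine ⟨Function.update β i a, hne 0 hi0.symm, ?_⟩
  refine ⟨⟨h.inj_left, ?_, h.mem_left, ?_, ?_, ?_, ?_, ?_⟩, ?_, ?_⟩
  · intro m n hmn
    by_cases hm : m = i <;> by_cases hn : n = i
    · rw [hm, hn]
    · rw [hm, heq, hne n hn] at hmn
      exact absurd hmn (haβ n)
    · rw [hn, heq, hne m hm] at hmn
      exact absurd hmn.symm (haβ m)
    · rw [hne m hm, hne n hn] at hmn
      exact h.inj_right hmn
  · intro m
    by_cases hm : m = i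
    · rw [hm, heq]
      exact mem_erase.2 ⟨hαβ ▸ haβ i, ha.1.1⟩
    · rw [hne m hm, hαβ]
      exact mem_erase.2 ⟨fun he => hm (h.inj_right he), h.mem_right m⟩
  · intro m hm
    rw [mem_erase] at hm
    rw [hne m (by rintro rfl; exact hm.1 rfl)]
    exact h.eq_of_left_mem m hm.2
  · intro m hm
    by_cases hmi : m = i
    · rw [hmi, heq] at hm
      exact absurd hm ha.1.2
    · rw [hne m hmi] at hm ⊢
      exact h.eq_of_right_mem m hm
  · intro v hv hvR
    rw [mem_erase] at hvR
    obtain ⟨m, rfl, hm⟩ := h.exists_of_mem v hv hvR.2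
    exact ⟨m, rfl, by rwa [hne m (by rintro rfl; exact hvR.1 rfl)]⟩
  · rw [hne 0 hi0.symm]
    exact h.ne_zero
  · intro m hm
    by_cases hmi : m = i
    · rw [hmi, heq, hαβ]
      exact ha.2
    · rw [hne m hmi] at hm ⊢
      exact h.adj m hm
  · intro u hu huR w hw hwL huw
    rw [mem_erase] at huR hw
    by_cases huR' : u ∈ R
    · obtain rfl : u = α i := by
        by_contra hne
        exact huR ⟨hne, huR'⟩
      exact ⟨i, rfl, (huniq w hw.2 hwL (hαβ ▸ huw)).trans heq.symm⟩
    · obtain ⟨m, rfl, hm⟩ := h.exists_of_adj u hu huR' w hw.2 hwL huw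
      refine ⟨m, rfl, ?_⟩
      rw [hne m]
      · exact hm
      · rintro rfl
        exact huR' (hαβ ▸ h.mem_right m)

/-- Each exchange shrinks `L ∩ R`. It keeps both ends of port `0`, hence their degrees, and shrinks
neither `L \ R` nor `R \ L`. -/
lemma LinkedBy.exists_wellLinkedBy (hG : G.TriconnectedOn W) (n : ℕ) :
    ∀ (L R : Finset V) (α β : Fin 3 → V), #(L ∩ R) = n → G.LinkedBy L R α β → L ∪ R = W →
      2 ≤ #(L \ R) → 2 ≤ #(R \ L) → 4 ≤ #(G.nbrs W (α 0)) → 4 ≤ #(G.nbrs W (β 0)) →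
      ∃ (L R : Finset V) (α β : Fin 3 → V), G.WellLinkedBy L R α β ∧ L ∪ R = W ∧
        2 ≤ #(L \ R) ∧ 2 ≤ #(R \ L) ∧ 4 ≤ #(G.nbrs W (α 0)) ∧ 4 ≤ #(G.nbrs W (β 0)) := by
  induction n using Nat.strong_induction_on with
  | _ n ih =>
  intro L R α β hn h hW hL hR hα hβ
  subst hn
  subst hW
  by_cases h1 : ∀ i, α i = β i → 2 ≤ #(G.nbrs (L \ R) (α i))
  · by_cases h2 : ∀ i, α i = β i → 2 ≤ #(G.nbrs (R \ L) (β i))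
    · exact ⟨L, R, α, β, ⟨h, h1, h2⟩, rfl, hL, hR, hα, hβ⟩
    · push Not at h2
      obtain ⟨i, hi, hlt⟩ := h2
      obtain ⟨β', hβ', h'⟩ := h.exists_erase hG hβ hR hi (by omega)
      have hiL := h.mem_left i
      refine ih _ ?_ L (R.erase (α i)) α β' rfl h' ?_ ?_ ?_ hα (hβ'.symm ▸ hβ)
      · rw [inter_erase]
        exact card_erase_lt_of_mem (mem_inter.2 ⟨hiL, hi ▸ h.mem_right i⟩)
      · ext v
        by_cases hv : v = α i <;> simp [hv, hiL]
      · exact hL.trans (card_le_card (sdiff_subset_sdiff Subset.rfl (erase_subset _ _)))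
      · rwa [erase_sdiff_comm, erase_eq_of_notMem (by simp [hiL])]
  · push Not at h1
    obtain ⟨i, hi, hlt⟩ := h1
    obtain ⟨α', hα', h'⟩ := h.symm.exists_erase (by rwa [union_comm]) (by rwa [union_comm R])
      hL hi.symm (by omega)
    have hiR := h.mem_right i
    refine ih _ ?_ (L.erase (β i)) R α' β rfl h'.symm ?_ ?_ ?_ (hα'.symm ▸ hα) hβ
    · rw [erase_inter]
      exact card_erase_lt_of_mem (mem_inter.2 ⟨hi ▸ h.mem_left i, hiR⟩)
    · ext v
      by_cases hv : v = β i <;> simp [hv, hiR]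
    · rwa [erase_sdiff_comm, erase_eq_of_notMem (by simp [hiR])]
    · exact hR.trans (card_le_card (sdiff_subset_sdiff Subset.rfl (erase_subset _ _)))

lemma SuperminimalOn.exists_wellLinkedBy (hG : G.SuperminimalOn W) (hx : x ∈ W) (hy : y ∈ W)
    (hxy : G.Adj x y) (hx4 : 4 ≤ #(G.nbrs W x)) (hy4 : 4 ≤ #(G.nbrs W y)) :
    ∃ (L R : Finset V) (α β : Fin 3 → V), G.WellLinkedBy L R α β ∧ L ∪ R = W ∧
        2 ≤ #(L \ R) ∧ 2 ≤ #(R \ L) ∧ 4 ≤ #(G.nbrs W (α 0)) ∧ 4 ≤ #(G.nbrs W (β 0)) := by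
  obtain ⟨P, hP, Q, hQ, hxP, hyQ, hPQ, hadj, hX⟩ := hG.exists_separation hx hy hxy
  obtain ⟨X, hXdef⟩ : ∃ X, X = W \ (P ∪ Q) := ⟨_, rfl⟩
  rw [← hXdef] at hX
  have hXP : ∀ v ∈ P, v ∉ X := fun v hv hvX =>
    (mem_sdiff.1 (hXdef ▸ hvX)).2 (mem_union_left _ hv)
  have hXQ : ∀ v ∈ Q, v ∉ X := fun v hv hvX =>
    (mem_sdiff.1 (hXdef ▸ hvX)).2 (mem_union_right _ hv)
  have hPnQ : ∀ v ∈ P, v ∉ Q := fun v hv => Finset.disjoint_left.1 hPQ hv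
  have hmem : ∀ v ∈ W, v ∈ P ∨ v ∈ Q ∨ v ∈ X := by
    intro v hv
    rw [hXdef, mem_sdiff, mem_union]
    tauto
  have hP2 : (P.erase x).Nonempty ∧ 2 ≤ #P := by
    have hsub : G.nbrs W x ⊆ (P.erase x) ∪ insert y X := by
      intro w hw
      rw [mem_nbrs] at hw
      rw [mem_union, mem_erase, mem_insert]
      rcases hmem w hw.1 with h | h | h
      · exact Or.inl ⟨hw.2.ne', h⟩
      · exact Or.inr (Or.inl (hadj x hxP w h hw.2).2)
      · exact Or.inr (Or.inr h)
    have h1 := (card_le_card hsub).trans (card_union_le _ _)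
    have h2 := card_insert_le y X
    have h3 := card_erase_of_mem hxP
    exact ⟨card_pos.1 (by omega), by omega⟩
  have hQ2 : 2 ≤ #Q := by
    have hsub : G.nbrs W y ⊆ (Q.erase y) ∪ insert x X := by
      intro w hw
      rw [mem_nbrs] at hw
      rw [mem_union, mem_erase, mem_insert]
      rcases hmem w hw.1 with h | h | h
      · exact Or.inr (Or.inl (hadj w h y hyQ hw.2.symm).1)
      · exact Or.inl ⟨hw.2.ne', h⟩
      · exact Or.inr (Or.inr h)
    have h1 := (card_le_card hsub).trans (card_union_le _ _)
    have h2 := card_insert_le x X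
    have h3 := card_erase_of_mem hyQ
    omega
  -- With fewer removed vertices, `x` could be removed as well, which would separate the rest of `P`
  -- from `Q` in `G`.
  have hX2 : #X = 2 := by
    by_contra hne
    refine hG.1.not_separated (P := P.erase x) (Q := Q) (X := insert x X)
      ((erase_subset _ _).trans hP) hQ hP2.1 ⟨y, hyQ⟩ (hPQ.mono_left (erase_subset _ _)) ?_ ?_
      ((card_insert_le _ _).trans (by omega))
    · intro u hu w hw huw
      rw [mem_erase] at hu
      exact hu.1 (hadj u hu.2 w hw huw).1
    · intro v hv
      have := hmem v hv
      simp only [mem_union, mem_erase, mem_insert]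
      tauto
  obtain ⟨a, b, hab, rfl⟩ := card_eq_two.1 hX2
  simp only [mem_insert, mem_singleton, not_or] at hXP hXQ hmem
  have haW : a ∈ W := (mem_sdiff.1 (hXdef ▸ mem_insert_self a {b})).1
  have hbW : b ∈ W := (mem_sdiff.1 (hXdef ▸ mem_insert_of_mem (mem_singleton_self b))).1
  have hLR : (P ∪ {a, b}) \ (Q ∪ {a, b}) = P := by
    ext v
    have h1 := hXP v
    have h2 := hPnQ v
    simp only [mem_sdiff, mem_union, mem_insert, mem_singleton]
    tauto
  have hRL : (Q ∪ {a, b}) \ (P ∪ {a, b}) = Q := by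
    ext v
    have h1 := hXQ v
    have h2 := hPnQ v
    simp only [mem_sdiff, mem_union, mem_insert, mem_singleton]
    tauto
  have hxX := hXP x hxP
  have hyX := hXQ y hyQ
  refine LinkedBy.exists_wellLinkedBy hG.1 _ (P ∪ {a, b}) (Q ∪ {a, b}) ![x, a, b] ![y, a, b] rfl
    ?_ ?_ (by rw [hLR]; exact hP2.2) (by rwa [hRL]) hx4 hy4
  · refine ⟨⟨?_, ?_, ?_, ?_, ?_, ?_, ?_, ?_⟩, ?_, ?_⟩
    · intro i j hij
      fin_cases i <;> fin_cases j <;>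
        simp [hxX.1, hxX.2, Ne.symm hxX.1, Ne.symm hxX.2, hab, hab.symm] at hij ⊢
    · intro i j hij
      fin_cases i <;> fin_cases j <;>
        simp [hyX.1, hyX.2, Ne.symm hyX.1, Ne.symm hyX.2, hab, hab.symm] at hij ⊢
    · intro i
      fin_cases i <;> simp [hxP]
    · intro i
      fin_cases i <;> simp [hyQ]
    · intro i hi
      fin_cases i
      · have := hPnQ x hxP
        simp_all
      · rfl
      · rfl
    · intro i hi
      fin_cases i
      · have := fun h => hPnQ y h hyQ
        simp_all
      · rfl
      · rfl
    · intro v hvL hvR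
      have h1 := hPnQ v
      simp only [mem_union, mem_insert, mem_singleton] at hvL hvR
      have : v = a ∨ v = b := by tauto
      rcases this with rfl | rfl
      · exact ⟨1, rfl, rfl⟩
      · exact ⟨2, rfl, rfl⟩
    · exact hxy.ne
    · intro i hi
      fin_cases i
      · exact hxy
      · exact absurd rfl hi
      · exact absurd rfl hi
    · intro u hu hu' w hw hw' huw
      have huP : u ∈ P := hLR ▸ mem_sdiff.2 ⟨hu, hu'⟩
      have hwQ : w ∈ Q := hRL ▸ mem_sdiff.2 ⟨hw, hw'⟩
      exact ⟨0, hadj u huP w hwQ huw⟩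
  · ext v
    have h1 := hmem v
    have h2 := @hP v
    have h3 := @hQ v
    simp only [mem_union, mem_insert, mem_singleton]
    constructor
    · rintro ((h | rfl | rfl) | h | rfl | rfl) <;> tauto
    · tauto

/-! ### The induction -/

theorem SuperminimalOn.hubbedOn_or (n : ℕ) : ∀ (W : Finset V) (G : SimpleGraph V), #W = n →
    G.SuperminimalOn W → G.HubbedOn W ∨ G.degreeSumOn W + 6 ≤ 4 * #W := by
  induction n using Nat.strong_induction_on with
  | _ n ih =>
  intro W G hn hG
  by_cases hind : ∀ u ∈ W, ∀ w ∈ W, G.Adj u w → #(G.nbrs W u) = 3 ∨ #(G.nbrs W w) = 3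
  · exact hubbedOn_or_of_indep hG hind
  push Not at hind
  obtain ⟨x, hx, y, hy, hxy, hx3, hy3⟩ := hind
  have hx4 := hG.1.three_le_card_nbrs hx
  have hy4 := hG.1.three_le_card_nbrs hy
  obtain ⟨L, R, α, β, h, rfl, hL, hR, hα, hβ⟩ :=
    hG.exists_wellLinkedBy hx hy hxy (by omega) (by omega)
  right
  have hLR := card_union_add_card_inter L R
  have h1 : #(R \ L) + #L = #(L ∪ R) := by
    rw [← card_union_of_disjoint sdiff_disjoint, sdiff_union_self_eq_union, union_comm]
  have h2 : #(L \ R) + #R = #(L ∪ R) := by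
    rw [← card_union_of_disjoint sdiff_disjoint, sdiff_union_self_eq_union]
  have hLc := card_insert_of_notMem h.zero_notMem_left
  have hRc := card_insert_of_notMem h.zero_notMem_right
  have hG' : G.SuperminimalOn (R ∪ L) := by rwa [union_comm]
  have hD := h.degreeSumOn_add fun u hu w hw => h.not_adj_of_mem_inter hG hu hw
  have hA := ih _ (by omega) _ _ rfl (h.superminimalOn_left hG)
  have hB := ih _ (by omega) _ _ rfl (h.symm.superminimalOn_left hG')
  have hS : #(L ∩ R) ≤ 2 := by
    have h3 := h.card_inter_add
    have : 0 < #{i | α i ≠ β i} := card_pos.2 ⟨0, by simp [h.ne_zero]⟩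
    omega
  -- Let `s = #(L ∩ R)`; the side graphs have `#(L ∪ R) + s + 2` vertices together. For `s = 0` the
  -- weak bound `4 * n - 4` on both sides suffices. For `s > 0` the bounds `4 * n - 6` leave an
  -- excess of `2 * s - 4`, which is at most zero.
  rcases (L ∩ R).eq_empty_or_nonempty with he | hne
  · have hA' : (G.sideGraph L R α (β 0)).degreeSumOn (insert (β 0) L) + 4 ≤
        4 * #(insert (β 0) L) := hA.elim (fun h => h.degreeSumOn_add.le) fun h => by omega
    have hB' : (G.sideGraph R L β (α 0)).degreeSumOn (insert (α 0) R) + 4 ≤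
        4 * #(insert (α 0) R) := hB.elim (fun h => h.degreeSumOn_add.le) fun h => by omega
    rw [he, card_empty] at hD hLR
    omega
  · have hA' := hA.resolve_left (h.not_hubbedOn hG hα hne)
    have hB' := hB.resolve_left (h.symm.not_hubbedOn hG' (by rwa [union_comm R])
      (by rwa [inter_comm]))
    omega

/-! ### Wheels, and passage to the original definitions -/

lemma exists_iso_cycleGraph {U : Type*} [Finite U] {C : SimpleGraph U} (hC : C.Connected)
    (h2 : ∀ v, (C.neighborSet v).ncard = 2) : ∃ n, 3 ≤ n ∧ Nonempty (C ≃g cycleGraph n) := by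
  have hcyc : C.IsCycles := fun v _ => h2 v
  obtain ⟨v⟩ := hC.nonempty
  obtain ⟨p, hp, hpv⟩ := hcyc.exists_cycle_toSubgraph_verts_eq_connectedComponentSupp
    (c := C.connectedComponentMk v) rfl (Set.nonempty_of_ncard_ne_zero (by rw [h2]; decide))
  have hsupp : ∀ w, w ∈ p.support := by
    intro w
    rw [← Walk.mem_verts_toSubgraph, hpv]
    exact ConnectedComponent.eq.2 (hC.preconnected w v)
  obtain ⟨m, hm⟩ : ∃ m, p.length = m + 3 := ⟨p.length - 3, by have := hp.three_le_length; omega⟩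
  let f : Fin (m + 3) → U := fun i => p.getVert i
  have hf : Function.Injective f := by
    intro i j hij
    exact Fin.ext (hp.getVert_injOn' (by simp; omega) (by simp; omega) hij)
  have hf' : Function.Surjective f := by
    intro w
    obtain ⟨i, hi, hil⟩ := Walk.mem_support_iff_exists_getVert.1 (hsupp w)
    rcases Nat.lt_or_ge i (m + 3) with h | h
    · exact ⟨⟨i, h⟩, hi⟩
    · refine ⟨0, ?_⟩
      have : i = p.length := by omega
      rw [this, Walk.getVert_length] at hi
      simpa [f] using hi
  have hadj : ∀ i, C.Adj (f i) (f (i + 1)) := by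
    intro i
    have h1 := p.adj_getVert_succ (i := i) (by omega)
    have h3 : f (i + 1) = p.getVert (i + 1) := by
      by_cases hi : i = Fin.last (m + 2)
      · subst hi
        simp only [Fin.last_add_one, f, Fin.val_last]
        have h0 : p.getVert (m + 2 + 1) = v := by
          rw [show m + 2 + 1 = p.length by omega, Walk.getVert_length]
        rw [h0, Fin.val_zero, Walk.getVert_zero]
      · simp only [f]
        rw [Fin.val_add_one_of_lt (Fin.lt_last_iff_ne_last.2 hi)]
    rw [h3]
    exact h1
  have hle : ∀ i j, (cycleGraph (m + 3)).Adj i j → C.Adj (f i) (f j) := by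
    intro i j hij
    rcases cycleGraph_adj.1 hij with h | h
    · rw [sub_eq_iff_eq_add'] at h
      rw [h]
      exact (hadj j).symm
    · rw [sub_eq_iff_eq_add'] at h
      rw [h]
      exact hadj i
  refine ⟨m + 3, by omega, ⟨RelIso.symm ⟨Equiv.ofBijective f ⟨hf, hf'⟩, ?_⟩⟩⟩
  intro i j
  refine ⟨fun h => ?_, hle i j⟩
  -- The spanning cycle has no chords, as its two neighbours already exhaust the degree.
  have hsub : f '' (cycleGraph (m + 3)).neighborSet i ⊆ C.neighborSet (f i) := by
    rintro _ ⟨j, hj, rfl⟩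
    exact hle i j hj
  have heq := Set.eq_of_subset_of_ncard_le hsub (by
    rw [h2, Set.ncard_image_of_injective _ hf, ← coe_neighborFinset, Set.ncard_coe_finset,
      card_neighborFinset_eq_degree, cycleGraph_degree_three_le]) (Set.toFinite _)
  have hj : f j ∈ C.neighborSet (f i) := h
  rw [← heq] at hj
  obtain ⟨k, hk, hkj⟩ := hj
  exact hf hkj ▸ hk

lemma IsKConnected.triconnectedOn [Fintype V] (h : G.IsKConnected 3) :
    G.TriconnectedOn univ := by
  refine ⟨by simpa [Nat.succ_le_iff] using h.1, fun P _ Q _ ⟨p, hp⟩ ⟨q, hq⟩ hPQ hadj => ?_⟩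
  by_contra! hlt
  have hc := h.2 _ hlt
  have hpX : p ∉ univ \ (P ∪ Q) := by simp [hp]
  have hqX : q ∉ univ \ (P ∪ Q) := by simp [hq]
  obtain ⟨w⟩ := hc.preconnected ⟨p, hpX⟩ ⟨q, hqX⟩
  obtain ⟨d, -, hd1, hd2⟩ := w.exists_boundary_dart {v | v.1 ∈ P} hp
    (fun h => Finset.disjoint_left.1 hPQ h hq)
  have hdX : d.snd.1 ∉ univ \ (P ∪ Q) := d.snd.2
  have : d.snd.1 ∈ Q := by
    simp only [mem_sdiff, mem_univ, true_and, not_not, mem_union] at hdX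
    exact hdX.resolve_left hd2
  exact hadj _ hd1 _ this d.adj

lemma Subgraph.isKConnected_coe [Finite V] {S : G.Subgraph} (hS : S.verts = W)
    (h : S.spanningCoe.TriconnectedOn W) : S.coe.IsKConnected 3 := by
  classical
  have hmem : ∀ v, v ∈ S.verts ↔ v ∈ W := fun v => by rw [hS, mem_coe]
  constructor
  · rw [Nat.card_coe_set_eq, hS, Set.ncard_coe_finset]
    exact h.1
  intro X hX
  have hXc : #(X.map (Function.Embedding.subtype _)) ≤ 2 := by
    rw [card_map]
    omega
  rw [connected_iff]
  constructor
  · intro a b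
    by_contra hab
    -- The vertices reachable from `a` after deleting `X` form one side of a separation.
    let T : Finset V := {v ∈ W | ∃ (h : v ∈ S.verts) (h' : (⟨v, h⟩ : S.verts) ∉ X),
      (S.coe.induce {v | v ∉ X}).Reachable a ⟨⟨v, h⟩, h'⟩}
    refine h.not_separated (P := T) (Q := W \ (T ∪ X.map (Function.Embedding.subtype _)))
      (X := X.map (Function.Embedding.subtype _)) (filter_subset _ _) sdiff_subset
      ⟨a.1.1, mem_filter.2 ⟨(hmem _).1 a.1.2, a.1.2, a.2, Reachable.refl _⟩⟩
      ⟨b.1.1, ?_⟩ ?_ ?_ ?_ hXc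
    · simp only [mem_sdiff, mem_union, not_or]
      refine ⟨(hmem _).1 b.1.2, fun hb => ?_, fun hb => ?_⟩
      · obtain ⟨-, h1, h2, h3⟩ := mem_filter.1 hb
        exact hab h3
      · obtain ⟨c, hc, hcb⟩ := mem_map.1 hb
        have : c = b.1 := Subtype.ext hcb
        exact b.2 (this ▸ hc)
    · rw [Finset.disjoint_right]
      intro v hv hv'
      exact (mem_sdiff.1 hv).2 (mem_union_left _ hv')
    · intro u hu w hw huw
      obtain ⟨-, hu1, hu2, hu3⟩ := mem_filter.1 hu
      rw [mem_sdiff, mem_union, not_or] at hw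
      have hwS : w ∈ S.verts := (hmem w).2 hw.1
      have hwX : (⟨w, hwS⟩ : S.verts) ∉ X := fun h => hw.2.2 (mem_map.2 ⟨_, h, rfl⟩)
      refine hw.2.1 (mem_filter.2 ⟨hw.1, hwS, hwX, hu3.trans (Adj.reachable ?_)⟩)
      exact huw
    · intro v hv
      simp only [mem_union, mem_sdiff]
      tauto
  · have h4 := h.1
    have : ¬ W ⊆ X.map (Function.Embedding.subtype _) := fun hsub => by
      have := card_le_card hsub
      omega
    obtain ⟨v, hv, hvX⟩ := not_subset.1 this
    exact ⟨⟨⟨v, (hmem v).2 hv⟩, fun h => hvX (mem_map.2 ⟨_, h, rfl⟩)⟩⟩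

lemma IsSuperMinimallyKConnected.superminimalOn [Fintype V]
    (h : G.IsSuperMinimallyKConnected 3) : G.SuperminimalOn univ := by
  refine ⟨h.1.triconnectedOn, fun W _ H hHG hH => ?_⟩
  let S : G.Subgraph :=
    { verts := W
      Adj := fun u w => H.Adj u w ∧ u ∈ W ∧ w ∈ W
      adj_sub := fun h => hHG h.1
      edge_vert := fun h => h.2.1
      symm := ⟨fun u w h => ⟨h.1.symm, h.2.2, h.2.1⟩⟩ }
  have hS : S = ⊤ := by
    by_contra hne
    exact h.2 S hne (Subgraph.isKConnected_coe (W := W) rfl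
      (hH.mono fun u hu w hw huw => ⟨huw, hu, hw⟩))
  constructor
  · ext v
    have : v ∈ S.verts := by rw [hS]; trivial
    exact iff_of_true this (mem_univ v)
  · intro u _ w _ huw
    have : S.Adj u w := by rw [hS]; exact huw
    exact this.1

lemma degreeSumOn_univ [Fintype V] [DecidableRel G.Adj] :
    G.degreeSumOn univ = 2 * #G.edgeFinset := by
  rw [← sum_degrees_eq_twice_card_edges, degreeSumOn]
  refine sum_congr rfl fun u _ => ?_
  rw [← card_neighborFinset_eq_degree]
  congr 1
  ext w
  simp

lemma HubbedOn.isWheel [Fintype V] (hG : G.IsKConnected 3) (h : G.HubbedOn univ) :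
    G.IsWheel := by
  classical
  obtain ⟨c, -, hc⟩ := h
  have hne : ∀ v : {v : V | v ∉ ({c} : Finset V)}, v.1 ≠ c := fun v => by simpa using v.2
  obtain ⟨n, hn, ⟨e⟩⟩ := exists_iso_cycleGraph (hG.2 {c} (by simp)) (by
    intro v
    have h3 := (hc v.1 (mem_univ _) (hne v)).2
    have hcv : c ∈ G.nbrs univ v.1 := mem_nbrs.2 ⟨mem_univ _, (hc v.1 (mem_univ _) (hne v)).1.symm⟩
    have h2 := card_erase_of_mem hcv
    rw [h3] at h2
    rw [← Set.ncard_image_of_injective _ Subtype.val_injective, show 2 = 3 - 1 from rfl, ← h2, ← Set.ncard_coe_finset]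
    congr 1
    ext w
    simp only [Set.mem_image, mem_neighborSet, coe_erase, Set.mem_sdiff, mem_coe, mem_nbrs,
      mem_univ, true_and, Set.mem_singleton_iff]
    constructor
    · rintro ⟨x, hx, rfl⟩
      exact ⟨hx, hne x⟩
    · rintro ⟨hw, hwc⟩
      exact ⟨⟨w, by simpa using hwc⟩, hw, rfl⟩)
  refine ⟨n, hn, ⟨RelIso.symm ⟨⟨fun o => o.elim c fun i => (e.symm i).1, fun v =>
    if hv : v ∉ ({c} : Finset V) then some (e ⟨v, hv⟩) else none, ?_, ?_⟩, ?_⟩⟩⟩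
  · rintro (_ | i)
    · simp
    · have := hne (e.symm i)
      simp [this]
  · intro v
    by_cases hv : v = c
    · simp [hv]
    · simp [hv]
  · rintro (_ | i) (_ | j)
    · simp [wheelGraph]
    · have := (hc _ (mem_univ _) (hne (e.symm j))).1
      simpa [wheelGraph] using this
    · have := (hc _ (mem_univ _) (hne (e.symm i))).1.symm
      simpa [wheelGraph] using this
    · have := e.symm.map_rel_iff' (a := i) (b := j)
      exact this

lemma IsWheel.hubbedOn [Fintype V] (h : G.IsWheel) : G.HubbedOn univ := by
  classical
  obtain ⟨n, hn, ⟨e⟩⟩ := h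
  obtain ⟨m, rfl⟩ : ∃ m, n = m + 3 := ⟨n - 3, by omega⟩
  refine ⟨e.symm none, mem_univ _, fun u _ hu => ?_⟩
  obtain ⟨i, hi⟩ : ∃ i, e u = some i := by
    rw [← Option.ne_none_iff_exists']
    intro hnone
    exact hu (by rw [← hnone, RelIso.symm_apply_apply])
  constructor
  · rw [← e.map_adj_iff, hi, RelIso.apply_symm_apply]
    trivial
  · have : (G.nbrs univ u).map e.toEquiv.toEmbedding =
        insertNone ((cycleGraph (m + 3)).neighborFinset i) := by
      ext o
      simp only [mem_map_equiv, mem_nbrs, mem_univ, true_and]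
      rw [← e.map_adj_iff, hi]
      rw [show e (e.toEquiv.symm o) = o from e.toEquiv.apply_symm_apply o]
      rcases o with _ | j
      · simp [wheelGraph]
      · simp [wheelGraph]
    rw [← card_map e.toEquiv.toEmbedding, this, card_insertNone, card_neighborFinset_eq_degree,
      cycleGraph_degree_three_le]

end SimpleGraph

end

theorem mainTheorem2 {V : Type*} [Fintype V] (G : SimpleGraph V) [DecidableRel G.Adj]
    (hG : G.IsSuperMinimallyKConnected 3) :
    (G.edgeFinset.card : ℤ) ≤ 2 * (Fintype.card V : ℤ) - 2 ∧
      ((G.edgeFinset.card : ℤ) = 2 * (Fintype.card V : ℤ) - 2 ↔ G.IsWheel) := by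
  classical
  have hD := G.degreeSumOn_univ
  have hV : (Finset.univ : Finset V).card = Fintype.card V := Finset.card_univ
  have hmain := SimpleGraph.SuperminimalOn.hubbedOn_or _ Finset.univ G rfl hG.superminimalOn
  refine ⟨?_, fun heq => ?_, fun hw => ?_⟩
  · rcases hmain with h | h
    · have := h.degreeSumOn_add
      omega
    · omega
  · refine (hmain.resolve_right fun h => ?_).isWheel hG.1
    omega
  · have := hw.hubbedOn.degreeSumOn_add
    omega
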